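/- Let $K$ be a field and let $Q=(Q_0,Q_1)$ be a strongly locally finite quiver (every vertex starts and ends only finitely many arrows, and there are only finitely many paths between any two vertices). Let $*\in Q_0$ be a source (no arrow ends at $*$), let $I$ be a two-sided ideal of the path algebra $KQ$, and let $\mathcal C=K\mathcal Q/\mathcal I$ be the associated path category: its objects are the finite formal direct sums of vertices and its morphisms are the matrices of linear combinations of paths, modulo the matrices with all entries in $I$. Let $\mathcal U=\mathrm{add}(Q_0\setminus\{*\})$ and $\mathcal T=\mathrm{add}\{*\}$ be the full subcategories of $\mathcal C$ formed by the finite direct sums of vertices $\neq *$, respectively of copies of $*$. Let $$\Lambda=\begin{pmatrix}\mathcal T&0\\ M&\mathcal U\end{pmatrix},\qquad M(U,T)=\mathcal C(T,U),$$ be the triangular matrix category: its objects are the pairs $(T,U)$ with $T\in\mathcal T$ and $U\in\mathcal U$, its morphisms $(T,U)\to(T',U')$ are the matrices $\begin{pmatrix}f&0\\h&g\end{pmatrix}$ with $f\in\mathcal C(T,T')$, $h\in\mathcal C(T,U')$, $g\in\mathcal C(U,U')$, and composition is matrix multiplication. (Thus $\Lambda$ is equivalent to $\mathcal C$.) For an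 additive category $\mathcal A$, let $\mathrm{Mod}\,\mathcal A$ be the abelian category of additive covariant functors from $\mathcal A$ to abelian groups, and let $\mathrm{mod}\,\mathcal A$ be its full subcategory of finitely presented objects, i.e. those $F$ with an exact sequence $P_1\to P_0\to F\to 0$ with $P_0,P_1$ finitely generated projective. $\mathrm{Ext}^j_{\mathcal A}$ and projective dimension $\mathrm{pd}_{\mathcal A}$ are taken in $\mathrm{Mod}\,\mathcal A$. A pair $X,Y$ in $\mathrm{mod}\,\mathcal A$ is orthogonal if $\mathrm{Ext}^j_{\mathcal A}(X,Y)=\mathrm{Ext}^j_{\mathcal A}(Y,X)=0$ for all $j\ge 1$, and exceptional if in addition $\mathrm{pd}_{\mathcal A}X<\infty$ and $\mathrm{pd}_{\mathcal A}Y<\infty$. Assume that $\Lambda$ is a one-point extension of $\mathcal U$ by a projective, i.e. that the $\mathcal U$-module $\mathcal C(*,-)|_{\mathcal U}$ is projective in $\mathrm{Mod}\,\mathcal U$. For a $\Lambda$-module $F$ and a $\mathcal U$-module $G$ put $$(\mathcal R F)(U)=F(0,U),\qquad (\mathcal E G)(X)=\mathrm{Hom}_{\mathcal U}\big(\Lambda(X,(0,-)),G\big),$$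 so that $(\mathcal E G)(*,0)\cong\mathrm{Hom}_{\mathcal U}(\mathcal C(*,-)|_{\mathcal U},G)$ and $(\mathcal E G)(0,U)\cong G(U)$. Then: 1. $\mathcal R$ and $\mathcal E$ send finitely presented modules to finitely presented modules, and they give additive functors $\mathcal R:\mathrm{mod}\,\Lambda\to\mathrm{mod}\,\mathcal U$ and $\mathcal E:\mathrm{mod}\,\mathcal U\to\mathrm{mod}\,\Lambda$ with $\mathcal R$ left adjoint to $\mathcal E$. 2. $\mathcal R$ and $\mathcal E$ preserve orthogonality: if $X,Y$ in $\mathrm{mod}\,\Lambda$ are orthogonal then so are $\mathcal RX,\mathcal RY$, and if $M,N$ in $\mathrm{mod}\,\mathcal U$ are orthogonal then so are $\mathcal EM,\mathcal EN$. 3. $\mathcal R$ and $\mathcal E$ preserve exceptional pairs in the same sense. Moreover, every object of $\mathrm{mod}\,\Lambda$ has finite projective dimension if and only if every object of $\mathrm{mod}\,\mathcal U$ does. -/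

import Mathlib

open CategoryTheory CategoryTheory.Limits Opposite

universe u

/-! ### Quivers, path categories and their quotients -/

/-- A quiver is strongly locally finite if every vertex starts and ends only finitely many
arrows, and there are only finitely many paths between any two vertices. -/
structure StronglyLocallyFinite (V : Type u) [Quiver.{u} V] : Prop where
  finite_out : ∀ x : V, Finite (Σ y : V, x ⟶ y)
  finite_in : ∀ x : V, Finite (Σ y : V, y ⟶ x)
  finite_paths : ∀ x y : V, Finite (Quiver.Path x y)

/-- A source is a vertex at which no arrow ends. -/
def IsSourceVertex {V : Type u} [Quiver.{u} V] (x : V) : Prop :=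
  ∀ y : V, IsEmpty (y ⟶ x)

/-- The `K`-category whose objects are the vertices and whose morphisms `a ⟶ b` are the formal
`K`-linear combinations of the paths from `a` to `b`, with concatenation as composition. -/
abbrev VertexCat (K V : Type u) [Field K] [Quiver.{u} V] : Type u :=
  Free K (Paths V)

/-- A two-sided ideal `I` of the path algebra `KQ`, given by its components `I(a,b)`, the
subspace of those elements of `I` that are combinations of paths from `a` to `b`. (Every two-sided
ideal of `KQ` is the direct sum of its components, as one sees by multiplying with trivial paths.)
-/
structure PathIdeal (K V : Type u) [Field K] [Quiver.{u} V] where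
  component : ∀ a b : VertexCat K V, Submodule K (a ⟶ b)
  comp_mem_left : ∀ {a b c : VertexCat K V} (f : a ⟶ b) {g : b ⟶ c},
    g ∈ component b c → f ≫ g ∈ component a c
  comp_mem_right : ∀ {a b c : VertexCat K V} {f : a ⟶ b} (g : b ⟶ c),
    f ∈ component a b → f ≫ g ∈ component a c

/-- A formal finite direct sum `X 0 ⊕ ⋯ ⊕ X (n - 1)` of vertices (the zero object if `n = 0`). -/
structure VertexSum (V : Type u) where
  n : ℕ
  X : Fin n → V

/-- A formal direct sum of vertices as an object of Mathlib's category of matrices over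
`VertexCat K V`. -/
def VertexSum.toMat (K : Type u) {V : Type u} [Field K] [Quiver.{u} V] (S : VertexSum V) :
    Mat_ (VertexCat K V) where
  ι := Fin S.n
  X := fun i => Free.of K (show Paths V from S.X i)

/-- The path category of the quiver: objects are the formal finite direct sums of vertices,
morphisms are the matrices of linear combinations of paths. -/
abbrev PathCat (K V : Type u) [Field K] [Quiver.{u} V] : Type u :=
  InducedCategory (Mat_ (VertexCat K V)) (VertexSum.toMat K (V := V))

section Bound

variable {K V : Type u} [Field K] [Quiver.{u} V]

/-- Congruence modulo the ideal of the path category generated by `I`, which consists of the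
matrices all of whose entries lie in `I`. -/
def PathIdeal.rel (I : PathIdeal K V) : HomRel (PathCat K V) :=
  fun S T f g => ∀ (i : Fin S.n) (j : Fin T.n), f.hom i j - g.hom i j ∈ I.component _ _

instance (I : PathIdeal K V) : Congruence I.rel where
  equivalence := {
    refl := fun f i j => by simp
    symm := fun {f g} h i j => by
      have := (I.component _ _).neg_mem (h i j)
      rwa [neg_sub] at this
    trans := fun {f g k} h h' i j => by
      have := (I.component _ _).add_mem (h i j) (h' i j)
      rwa [sub_add_sub_cancel] at this }
  comp_left := by
    intro S T W f g g' h i k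
    have : (f ≫ g).hom i k - (f ≫ g').hom i k =
        ∑ j : Fin T.n, f.hom i j ≫ (g.hom j k - g'.hom j k) := by
      simp only [Preadditive.comp_sub, Finset.sum_sub_distrib]
      rfl
    rw [this]
    exact Submodule.sum_mem _ fun j _ => I.comp_mem_left _ (h j k)
  comp_right := by
    intro S T W f f' g h i k
    have : (f ≫ g).hom i k - (f' ≫ g).hom i k =
        ∑ j : Fin T.n, (f.hom i j - f'.hom i j) ≫ g.hom j k := by
      simp only [Preadditive.sub_comp, Finset.sum_sub_distrib]
      rfl
    rw [this]
    exact Submodule.sum_mem _ fun j _ => I.comp_mem_right _ (h i j)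

/-- The quotient of the path category by the ideal generated by `I`. -/
abbrev BoundCat (I : PathIdeal K V) : Type u := CategoryTheory.Quotient I.rel

noncomputable instance (I : PathIdeal K V) : Preadditive (BoundCat I) :=
  Quotient.preadditive I.rel (by
    intro S T f₁ f₂ g₁ g₂ h h' i j
    have := (I.component _ _).add_mem (h i j) (h' i j)
    rwa [sub_add_sub_comm] at this)

/-- A vertex as an object of `BoundCat I`. -/
def BoundCat.vertex (I : PathIdeal K V) (x : V) : BoundCat I :=
  ⟨(⟨1, fun _ => x⟩ : VertexSum V)⟩

/-- `add s`: the finite direct sums of vertices that belong to `s`. -/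
def addVertices (I : PathIdeal K V) (s : Set V) : ObjectProperty (BoundCat I) :=
  fun S => ∀ i : Fin (VertexSum.n S.as), VertexSum.X S.as i ∈ s

/-- The zero object of `add s`, the empty direct sum. -/
def addVertices.zero (I : PathIdeal K V) (s : Set V) : (addVertices I s).FullSubcategory :=
  ⟨⟨(⟨0, Fin.elim0⟩ : VertexSum V)⟩, fun i => Fin.elim0 i⟩

theorem addVertices.isZero_zero (I : PathIdeal K V) (s : Set V) :
    IsZero (addVertices.zero I s) := by
  rw [IsZero.iff_id_eq_zero]
  apply ObjectProperty.hom_ext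
  change Quot.mk _ _ = Quot.mk _ _
  congr 1
  apply InducedCategory.hom_ext
  apply Mat_.hom_ext
  intro i
  exact Fin.elim0 i

end Bound

/-! ### Triangular matrix categories -/

section Triangular

variable {C : Type u} [Category.{u} C] [Preadditive C]

/-- Objects of the triangular matrix category `(𝒯 0; M 𝒰)` of two full subcategories `𝒯`, `𝒰`
of `C` and the bimodule `M(U,T) = C(T,U)`: pairs of an object of `𝒯` and an object of `𝒰`. -/
structure TriMat (T U : ObjectProperty C) where
  t : T.FullSubcategory
  u : U.FullSubcategory

variable {T U : ObjectProperty C}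

/-- Morphisms `(f 0; h g)` of the triangular matrix category. -/
@[ext]
structure TriMat.Hom (X Y : TriMat T U) where
  f : X.t ⟶ Y.t
  h : X.t.obj ⟶ Y.u.obj
  g : X.u ⟶ Y.u

/-- Composition is the product of triangular matrices:
`(f' 0; h' g') (f 0; h g) = (f'f 0; h'f + g'h g'g)`. -/
instance : Category.{u} (TriMat T U) where
  Hom X Y := TriMat.Hom X Y
  id X := ⟨𝟙 _, 0, 𝟙 _⟩
  comp φ ψ := ⟨φ.f ≫ ψ.f, φ.f.hom ≫ ψ.h + φ.h ≫ ψ.g.hom, φ.g ≫ ψ.g⟩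
  id_comp φ := by ext <;> simp
  comp_id φ := by ext <;> simp
  assoc φ ψ χ := by ext <;> simp [add_assoc]

@[ext]
theorem TriMat.hom_ext {X Y : TriMat T U} {φ ψ : X ⟶ Y} (hf : φ.f = ψ.f) (hh : φ.h = ψ.h)
    (hg : φ.g = ψ.g) : φ = ψ :=
  TriMat.Hom.ext hf hh hg

instance (X Y : TriMat T U) : Zero (X ⟶ Y) := ⟨⟨0, 0, 0⟩⟩

instance (X Y : TriMat T U) : Add (X ⟶ Y) :=
  ⟨fun φ ψ => ⟨φ.f + ψ.f, φ.h + ψ.h, φ.g + ψ.g⟩⟩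

instance (X Y : TriMat T U) : Neg (X ⟶ Y) := ⟨fun φ => ⟨-φ.f, -φ.h, -φ.g⟩⟩

/-- Morphisms are added entrywise. -/
instance (X Y : TriMat T U) : AddCommGroup (X ⟶ Y) where
  add_assoc _ _ _ := TriMat.hom_ext (add_assoc _ _ _) (add_assoc _ _ _) (add_assoc _ _ _)
  zero_add _ := TriMat.hom_ext (zero_add _) (zero_add _) (zero_add _)
  add_zero _ := TriMat.hom_ext (add_zero _) (add_zero _) (add_zero _)
  add_comm _ _ := TriMat.hom_ext (add_comm _ _) (add_comm _ _) (add_comm _ _)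
  neg_add_cancel _ :=
    TriMat.hom_ext (neg_add_cancel _) (neg_add_cancel _) (neg_add_cancel _)
  nsmul := nsmulRec
  zsmul := zsmulRec

instance : Preadditive (TriMat T U) where
  add_comp X Y Z φ φ' ψ := by
    refine TriMat.hom_ext (Preadditive.add_comp _ _ _ _ _ _) ?_ (Preadditive.add_comp _ _ _ _ _ _)
    change (φ.f.hom + φ'.f.hom) ≫ ψ.h + (φ.h + φ'.h) ≫ ψ.g.hom =
      (φ.f.hom ≫ ψ.h + φ.h ≫ ψ.g.hom) + (φ'.f.hom ≫ ψ.h + φ'.h ≫ ψ.g.hom)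
    rw [Preadditive.add_comp, Preadditive.add_comp]
    abel
  comp_add X Y Z φ ψ ψ' := by
    refine TriMat.hom_ext (Preadditive.comp_add _ _ _ _ _ _) ?_ (Preadditive.comp_add _ _ _ _ _ _)
    change φ.f.hom ≫ (ψ.h + ψ'.h) + φ.h ≫ (ψ.g.hom + ψ'.g.hom) =
      (φ.f.hom ≫ ψ.h + φ.h ≫ ψ.g.hom) + (φ.f.hom ≫ ψ'.h + φ.h ≫ ψ'.g.hom)
    rw [Preadditive.comp_add, Preadditive.comp_add]
    abel

theorem TriMat.isZero_obj {z : T.FullSubcategory} (hz : IsZero z) : IsZero z.obj := by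
  rw [IsZero.iff_id_eq_zero] at hz ⊢
  exact congrArg (fun f : z ⟶ z => f.hom) hz

/-- The inclusion `𝒰 → (𝒯 0; M 𝒰)`, `U ↦ (0 0; M U)`, where `z` is a zero object of `𝒯`. -/
def TriMat.incl (z : T.FullSubcategory) (hz : IsZero z) : U.FullSubcategory ⥤ TriMat T U where
  obj X := ⟨z, X⟩
  map g := ⟨0, 0, g⟩
  map_id _ := TriMat.hom_ext (hz.eq_of_src _ _) rfl rfl
  map_comp _ _ := TriMat.hom_ext (hz.eq_of_src _ _)
    ((TriMat.isZero_obj hz).eq_of_src _ _) rfl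

instance (z : T.FullSubcategory) (hz : IsZero z) :
    (TriMat.incl (U := U) z hz).Additive where
  map_add := TriMat.hom_ext (add_zero _).symm (add_zero _).symm rfl

end Triangular

/-! ### Modules over a preadditive category -/

section Modules

/-- `Mod C`: the category of additive covariant functors from `C` to abelian groups. -/
abbrev ModCat (C : Type u) [Category.{u} C] [Preadditive C] : Type (u + 1) :=
  C ⥤+ AddCommGrpCat.{u}

section

variable {C : Type u} [Category.{u} C] [Preadditive C]

theorem additive_of_mono {F G : C ⥤ AddCommGrpCat.{u}} (α : F ⟶ G) [Mono α] (hG : G.Additive) :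
    F.Additive where
  map_add {X Y f g} := by
    rw [← cancel_mono (α.app Y)]
    simp [Preadditive.add_comp, Preadditive.comp_add, G.map_add]

theorem additive_of_epi {F G : C ⥤ AddCommGrpCat.{u}} (α : F ⟶ G) [Epi α] (hF : F.Additive) :
    G.Additive where
  map_add {X Y f g} := by
    rw [← cancel_epi (α.app X)]
    rw [← α.naturality, F.map_add, Preadditive.add_comp, α.naturality, α.naturality,
      Preadditive.comp_add]

instance : (additiveFunctor C AddCommGrpCat.{u}).IsClosedUnderSubobjects where
  prop_of_mono f _ h := additive_of_mono f h

instance : (additiveFunctor C AddCommGrpCat.{u}).IsClosedUnderQuotients where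
  prop_of_epi f _ h := additive_of_epi f h

instance : (additiveFunctor C AddCommGrpCat.{u}).ContainsZero where
  exists_zero := ⟨(Functor.const C).obj (AddCommGrpCat.of PUnit.{u + 1}), by
    rw [IsZero.iff_id_eq_zero]
    ext
    exact Subsingleton.elim (α := PUnit.{u + 1}) _ _, ⟨by
    intros
    ext
    exact Subsingleton.elim (α := PUnit.{u + 1}) _ _⟩⟩

instance : (additiveFunctor C AddCommGrpCat.{u}).IsClosedUnderFiniteProducts where
  isClosedUnderLimitsOfShape J _ :=
    { limitsOfShape_le := by
        rintro F ⟨p⟩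
        refine ⟨fun {X Y f g} => ?_⟩
        refine (isLimitOfPreserves ((evaluation C AddCommGrpCat.{u}).obj Y) p.isLimit).hom_ext
          fun j => ?_
        have : (p.diag.obj j).Additive := p.prop_diag_obj j
        change F.map (f + g) ≫ (p.π.app j).app Y = (F.map f + F.map g) ≫ (p.π.app j).app Y
        simp [Preadditive.add_comp, Preadditive.comp_add, (p.diag.obj j).map_add] }

/-- The functor `X ↦ C(X,-)` from `Cᵒᵖ` to `Mod C`. -/
def representable (C : Type u) [Category.{u} C] [Preadditive C] : Cᵒᵖ ⥤ ModCat C :=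
  (additiveFunctor C AddCommGrpCat.{u}).lift preadditiveCoyoneda
    (fun X => (inferInstance : (preadditiveCoyoneda.obj X).Additive))

/-- `F` is finitely generated: it is a quotient of some `C(X,-)`. (All categories to which this
is applied have finite direct sums, so that one representable functor is enough.) -/
def IsFG (F : ModCat C) : Prop :=
  ∃ (X : C) (p : (representable C).obj (op X) ⟶ F), Epi p

/-- `F` is finitely presented: there is an exact sequence `P₁ → P₀ → F → 0` with `P₁`, `P₀`
finitely generated projective. -/
def IsFP (F : ModCat C) : Prop :=
  ∃ (P₁ P₀ : ModCat C) (d : P₁ ⟶ P₀) (p : P₀ ⟶ F) (w : d ≫ p = 0),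
    Projective P₁ ∧ IsFG P₁ ∧ Projective P₀ ∧ IsFG P₀ ∧ (ShortComplex.mk d p w).Exact ∧ Epi p

/-- `mod C`: the full subcategory of `Mod C` of the finitely presented modules. -/
abbrev FPModCat (C : Type u) [Category.{u} C] [Preadditive C] : Type (u + 1) :=
  ObjectProperty.FullSubcategory (IsFP (C := C))

/-- `X` and `Y` are orthogonal: `Ext^j(X,Y) = 0` and `Ext^j(Y,X) = 0` for all `j ≥ 1`. -/
def IsOrthogonalPair (X Y : ModCat C) : Prop :=
  letI := HasExt.standard (ModCat C)
  ∀ j : ℕ, 1 ≤ j →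
    Subsingleton (Abelian.Ext.{u + 1} X Y j) ∧ Subsingleton (Abelian.Ext.{u + 1} Y X j)

/-- `X` has finite projective dimension. -/
def HasFinitePD (X : ModCat C) : Prop :=
  ∃ n : ℕ, HasProjectiveDimensionLE X n

/-- `X` and `Y` form an exceptional pair: they are orthogonal and have finite projective
dimension. -/
def IsExceptionalPair (X Y : ModCat C) : Prop :=
  IsOrthogonalPair X Y ∧ HasFinitePD X ∧ HasFinitePD Y

end

variable {A B : Type u} [Category.{u} A] [Preadditive A] [Category.{u} B] [Preadditive B]

/-- Restriction of modules along an additive functor `i : A ⥤ B`: `F ↦ F ∘ i`. -/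
def restrictAlong (i : A ⥤ B) [i.Additive] : ModCat B ⥤ ModCat A :=
  (additiveFunctor A AddCommGrpCat.{u}).lift
    (AdditiveFunctor.forget B AddCommGrpCat.{u} ⋙ (Functor.whiskeringLeft _ _ _).obj i)
    (fun F => (inferInstance : (i ⋙ F.obj).Additive))

instance (i : A ⥤ B) [i.Additive] : (restrictAlong i).Additive where

instance : (representable B).Additive where
  map_add {X Y f g} := by
    apply ObjectProperty.hom_ext
    ext Z h
    exact Preadditive.add_comp _ _ _ f.unop g.unop h

/-- Extension of modules along an additive functor `i : A ⥤ B`: it sends `G` to the `B`-module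
`X ↦ Hom_A (B(X, i -), G)`. -/
def extendAlong (i : A ⥤ B) [i.Additive] : ModCat A ⥤ ModCat B :=
  (additiveFunctor B AddCommGrpCat.{u}).lift
    (preadditiveYoneda ⋙ (Functor.whiskeringLeft _ _ _).obj
      ((representable B).rightOp ⋙ (restrictAlong i).op))
    (fun G => (inferInstance :
      (((representable B).rightOp ⋙ (restrictAlong i).op) ⋙ preadditiveYoneda.obj G).Additive))

end Modules

/-! ### Deleting a source vertex -/

section OnePoint

variable {K V : Type u} [Field K] [Quiver.{u} V] (I : PathIdeal K V) (star : V)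

/-- `𝒰 = add (Q₀ ∖ {*})`. -/
abbrev UCat : Type u := (addVertices I {x | x ≠ star}).FullSubcategory

/-- The triangular matrix category `Λ = (𝒯 0; M 𝒰)`, with `𝒯 = add {*}`, `𝒰 = add (Q₀ ∖ {*})` and
`M(U,T) = C(T,U)`, where `C = BoundCat I`. -/
abbrev LambdaCat : Type u := TriMat (addVertices I {star}) (addVertices I {x | x ≠ star})

/-- The inclusion `𝒰 → Λ`, `U ↦ (0 0; M U)`. -/
noncomputable def UCat.incl : UCat I star ⥤ LambdaCat I star :=
  TriMat.incl (addVertices.zero I {star}) (addVertices.isZero_zero I {star})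

instance : (UCat.incl I star).Additive :=
  inferInstanceAs (TriMat.incl _ _).Additive

/-- The extension module `C(*,-)|_𝒰`. -/
noncomputable def extensionModule : ModCat (UCat I star) :=
  (restrictAlong (addVertices I {x | x ≠ star}).ι).obj
    ((representable (BoundCat I)).obj (op (BoundCat.vertex I star)))

/-- The restriction functor `(ℛ F)(U) = F(0 0; M U)`. -/
noncomputable def restriction : ModCat (LambdaCat I star) ⥤ ModCat (UCat I star) :=
  restrictAlong (UCat.incl I star)

/-- The extension functor `(ℰ G)(X) = Hom_𝒰 (Λ(X, -)|_𝒰, G)`. As `Λ((* 0; M 0), -)|_𝒰` is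
`C(*,-)|_𝒰` and `Λ((0 0; M U), -)|_𝒰` is `𝒰(U,-)`, this is `Hom_𝒰 (C(*,-)|_𝒰, G)` at `*` and
`Hom_𝒰 (𝒰(U,-), G) ≅ G(U)` at `U`. -/
noncomputable def extension : ModCat (UCat I star) ⥤ ModCat (LambdaCat I star) :=
  extendAlong (UCat.incl I star)

/-- The functor `mod Λ ⥤ mod 𝒰` given by `ℛ`, if `ℛ` preserves finite presentation. -/
noncomputable def restrictionFP (h : ∀ F, IsFP F → IsFP ((restriction I star).obj F)) :
    FPModCat (LambdaCat I star) ⥤ FPModCat (UCat I star) :=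
  ObjectProperty.lift _ (ObjectProperty.ι _ ⋙ restriction I star) (fun F => h F.obj F.property)

/-- The functor `mod 𝒰 ⥤ mod Λ` given by `ℰ`, if `ℰ` preserves finite presentation. -/
noncomputable def extensionFP (h : ∀ G, IsFP G → IsFP ((extension I star).obj G)) :
    FPModCat (UCat I star) ⥤ FPModCat (LambdaCat I star) :=
  ObjectProperty.lift _ (ObjectProperty.ι _ ⋙ extension I star) (fun G => h G.obj G.property)

end OnePoint

/-! ### Dimension shifting in abelian categories -/

section Abstract

universe w w' v v' u₁ u₂

open Abelian

section Kernels

variable {A : Type u₁} [Category.{v} A] [Abelian A]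

/-! Let `J` be restriction along the projection `(T, U) ↦ U`, that is, extension of `𝒰`-modules by
zero. The inclusion `𝒰 → Λ` is left adjoint to this projection, so `J ⊣ ℛ ⊣ ℰ`, where `J` and `ℛ`
are exact and `J` is fully faithful; hence the counit `ℛℰ → 1` is an isomorphism. Projectivity of
`C(*,-)|_𝒰` makes every `Λ(X,-)|_𝒰` projective (`TriMat.projective_restrict_representable`), so `ℰ`
preserves epimorphisms and `ℛ` preserves projectives. By dimension shifting, `Ext^j(ℛX, N)` and
`Ext^j(X, ℰN)` vanish together for `j ≥ 1` (`subsingleton_ext_adjoint_iff`).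

Orthogonality passes through `ℰ` because `ℛℰM ≅ M`. For `ℛ`, the unit `Y → ℰℛY` has kernel and
cokernel killed by `ℛ`. Modules killed by `ℛ` are inflated from `𝒯 = add {*}`; since `*` is a
source, its endomorphisms are scalars and all `𝒯`-modules are injective and projective. Inflation
has an exact left adjoint, so the modules killed by `ℛ` are injective over `Λ`, and `Ext^j(X, Y) →
Ext^j(X, ℰℛY)` is onto for `j ≥ 1`.

The modules killed by `ℛ` also have projective dimension at most one
(`hasProjectiveDimensionLT_two_of_isZero_obj`). The exact sequence `0 → JℛX → X → Q → 0` then bounds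
the projective dimension of `X` by that of `ℛX`, up to one.

Finite presentation uses the finiteness of the quiver. Finitely many arrows leave `*`, so
`C(*,-)|_𝒰` is finitely generated; this handles `ℛ`. For `ℰG` the same sequence has the finitely
presented submodule `JG`, and the quotient comes from a `𝒯`-module that is finite-dimensional at
`*`, because there are finitely many paths between two vertices (`TriMat.isFP_extend`). -/

theorem shortExact_kernel {X Y : A} (f : X ⟶ Y) [Epi f] :
    (ShortComplex.mk _ _ (kernel.condition f)).ShortExact where
  exact := ShortComplex.exact_of_f_is_kernel _ (kernelIsKernel f)

theorem shortExact_cokernel {X Y : A} (f : X ⟶ Y) [Mono f] :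
    (ShortComplex.mk _ _ (cokernel.condition f)).ShortExact where
  exact := ShortComplex.exact_of_g_is_cokernel _ (cokernelIsCokernel f)

end Kernels

/-! ### Vanishing of Ext along short exact sequences. -/

section Shift

variable {A : Type u₁} [Category.{v} A] [Abelian A] [HasExt.{w} A]

theorem subsingleton_ext_shift {S : ShortComplex A} (hS : S.ShortExact) [Projective S.X₂] (Y : A)
    (n : ℕ) : Subsingleton (Ext.{w} S.X₃ Y (n + 2)) ↔ Subsingleton (Ext.{w} S.X₁ Y (n + 1)) := by
  constructor
  · refine fun h => subsingleton_of_forall_eq 0 fun x => ?_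
    obtain ⟨y, hy⟩ := Ext.contravariant_sequence_exact₁ hS Y x (n₁ := n + 2) (by omega)
      (Subsingleton.elim _ _)
    rw [← hy, y.eq_zero_of_projective, Ext.comp_zero]
  · refine fun h => subsingleton_of_forall_eq 0 fun x => ?_
    obtain ⟨y, hy⟩ := Ext.contravariant_sequence_exact₃ hS Y x (n₀ := n + 1)
      (Ext.eq_zero_of_projective _) (by omega)
    rw [← hy, Subsingleton.elim y 0, Ext.comp_zero]

/-- This turns degree one into an extension problem for morphisms, the form in which an adjunction
can be applied. -/
theorem subsingleton_ext_one_iff {S : ShortComplex A} (hS : S.ShortExact) [Projective S.X₂]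
    (Y : A) : Subsingleton (Ext.{w} S.X₃ Y 1) ↔ ∀ f : S.X₁ ⟶ Y, ∃ g : S.X₂ ⟶ Y, S.f ≫ g = f := by
  constructor
  · intro h f
    obtain ⟨y, hy⟩ := Ext.contravariant_sequence_exact₁ hS Y (Ext.mk₀ f) (n₁ := 1) (by omega)
      (Subsingleton.elim _ _)
    obtain ⟨g, rfl⟩ := Ext.addEquiv₀.symm.surjective y
    refine ⟨g, Ext.addEquiv₀.symm.injective ?_⟩
    simpa using hy
  · refine fun h => subsingleton_of_forall_eq 0 fun x => ?_
    obtain ⟨y, hy⟩ := Ext.contravariant_sequence_exact₃ hS Y x (n₀ := 0)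
      (Ext.eq_zero_of_projective _) (by omega)
    obtain ⟨f, rfl⟩ := Ext.addEquiv₀.symm.surjective y
    obtain ⟨g, rfl⟩ := h f
    rw [← hy, Ext.addEquiv₀_symm_apply, ← Ext.mk₀_comp_mk₀, hS.extClass_comp_assoc]

/-- A morphism with injective kernel and cokernel transports vanishing of the higher
`Ext`-groups. -/
theorem subsingleton_ext_of_injective_ker_coker {X Y Z : A} (f : Y ⟶ Z) [Injective (kernel f)]
    [Injective (cokernel f)] {n : ℕ} (h : Subsingleton (Ext.{w} X Y (n + 1))) :
    Subsingleton (Ext.{w} X Z (n + 1)) := by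
  have S₁ : (ShortComplex.mk (kernel.ι f) (factorThruImage f)
      (by rw [← cancel_mono (Limits.image.ι f)]; simp)).ShortExact :=
    { exact := (ShortComplex.exact_of_f_is_kernel _ (isKernelOfComp _ _ (kernelIsKernel f)
        (by rw [← cancel_mono (Limits.image.ι f)]; simp) (Limits.image.fac f))) }
  have S₂ : (ShortComplex.mk (Limits.image.ι f) (cokernel.π f) (by
      rw [← cancel_epi (factorThruImage f)]; simp)).ShortExact :=
    { exact := (ShortComplex.exact_of_g_is_cokernel _ (isCokernelOfComp (factorThruImage f) _
        (cokernelIsCokernel f)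
        (by rw [← cancel_epi (factorThruImage f)]; simp) (Limits.image.fac f))) }
  refine subsingleton_of_forall_eq 0 fun x => ?_
  -- A class on `Z` dies in the cokernel, so it comes from the image of `f`; the obstruction to
  -- lifting it further to `Y` lies in `Ext^(n+2)` of the kernel, which is zero.
  obtain ⟨y, rfl⟩ := Ext.covariant_sequence_exact₂ X S₂ x (Ext.eq_zero_of_injective _)
  obtain ⟨z, rfl⟩ := Ext.covariant_sequence_exact₃ X S₁ y (n₁ := n + 2) rfl
    (Ext.eq_zero_of_injective _)
  rw [Subsingleton.elim z 0, Ext.zero_comp, Ext.zero_comp]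

end Shift

/-! ### Ext and projective dimension under an exact left adjoint. -/

section Adjoint

variable {A : Type u₁} [Category.{v} A] [Abelian A] {B : Type u₂} [Category.{v'} B] [Abelian B]

omit [Abelian A] [Abelian B] in
theorem CategoryTheory.Adjunction.forall_exists_map_comp_iff {R : A ⥤ B} {E : B ⥤ A}
    (adj : R ⊣ E) {K P : A} (k : K ⟶ P) (N : B) :
    (∀ f : R.obj K ⟶ N, ∃ g : R.obj P ⟶ N, R.map k ≫ g = f) ↔
      ∀ f : K ⟶ E.obj N, ∃ g : P ⟶ E.obj N, k ≫ g = f := by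
  constructor
  · intro h f
    obtain ⟨g, hg⟩ := h ((adj.homEquiv _ _).symm f)
    refine ⟨adj.homEquiv _ _ g, (adj.homEquiv _ _).symm.injective ?_⟩
    rw [← hg, Adjunction.homEquiv_naturality_left_symm, Equiv.symm_apply_apply]
  · intro h f
    obtain ⟨g, hg⟩ := h (adj.homEquiv _ _ f)
    refine ⟨(adj.homEquiv _ _).symm g, (adj.homEquiv _ _).injective ?_⟩
    rw [← hg, Adjunction.homEquiv_naturality_left, Equiv.apply_symm_apply]

/-- If an exact functor `R` has an exact right adjoint `E`, then `Ext (R X) N` and `Ext X (E N)`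
vanish simultaneously. -/
theorem subsingleton_ext_adjoint_iff [EnoughProjectives A] [HasExt.{w} A] [HasExt.{w'} B]
    {R : A ⥤ B} {E : B ⥤ A} (adj : R ⊣ E) [R.Additive] [PreservesFiniteLimits R]
    [PreservesFiniteColimits R] [E.PreservesEpimorphisms] (n : ℕ) (X : A) (N : B) :
    Subsingleton (Ext.{w'} (R.obj X) N (n + 1)) ↔ Subsingleton (Ext.{w} X (E.obj N) (n + 1)) := by
  induction n generalizing X with
  | zero =>
    have hS := shortExact_kernel (Projective.π X)
    have hS' := hS.map_of_exact R
    -- `R` preserves projectives because its right adjoint preserves epimorphisms, so `R` of a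
    -- projective presentation is again one.
    have : Projective ((ShortComplex.mk _ _ (kernel.condition (Projective.π X))).map R).X₂ :=
      adj.map_projective _ (inferInstanceAs (Projective (Projective.over X)))
    refine (subsingleton_ext_one_iff hS' N).trans (Iff.trans ?_
      (subsingleton_ext_one_iff hS (E.obj N)).symm)
    exact adj.forall_exists_map_comp_iff _ _
  | succ n ih =>
    have hS := shortExact_kernel (Projective.π X)
    have hS' := hS.map_of_exact R
    have : Projective ((ShortComplex.mk _ _ (kernel.condition (Projective.π X))).map R).X₂ :=
      adj.map_projective _ (inferInstanceAs (Projective (Projective.over X)))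
    exact (subsingleton_ext_shift hS' N n).trans ((ih _).trans
      (subsingleton_ext_shift hS (E.obj N) n).symm)

theorem hasProjectiveDimensionLT_leftAdjoint [EnoughProjectives A]
    {R : A ⥤ B} {E : B ⥤ A} (adj : R ⊣ E) [R.Additive] [PreservesFiniteLimits R]
    [PreservesFiniteColimits R] [E.PreservesEpimorphisms] (n : ℕ) (X : A)
    [hX : HasProjectiveDimensionLT X (n + 1)] : HasProjectiveDimensionLT (R.obj X) (n + 1) := by
  let := HasExt.standard A
  let := HasExt.standard B
  refine HasProjectiveDimensionLT.mk fun i hi Y e => ?_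
  -- The comparison of Ext-groups is available in positive degrees only; `i ≥ n + 1` guarantees
  -- this.
  obtain ⟨m, rfl⟩ : ∃ m, i = m + 1 := ⟨i - 1, by omega⟩
  have := (subsingleton_ext_adjoint_iff adj m X Y).2
    (HasProjectiveDimensionLT.subsingleton X (n + 1) _ hi _)
  exact Subsingleton.elim _ _

end Adjoint

/-! ### Adjoint triples with a fully faithful left end. -/

section Triple

section

variable {A : Type u₁} [Category.{v} A] {B : Type u₂} [Category.{v'} B]
  {J : B ⥤ A} {R : A ⥤ B} {E : B ⥤ A} (adj₁ : J ⊣ R) (adj₂ : R ⊣ E) [IsIso adj₁.unit]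

include adj₁ in
-- In an adjoint triple the two outer functors are fully faithful simultaneously.
theorem isIso_counit_of_isIso_unit : IsIso adj₂.counit :=
  (Adjunction.Triple.mk adj₁ adj₂).isIso_unit_iff_isIso_counit.1 inferInstance

include adj₁ in
-- By a triangle identity, `R` of the unit is a one-sided inverse of an isomorphism. Thus the kernel
-- and cokernel of `X ⟶ E (R X)` are killed by `R`.
theorem isIso_map_unit (X : A) : IsIso (R.map (adj₂.unit.app X)) := by
  have := isIso_counit_of_isIso_unit adj₁ adj₂
  have h := adj₂.left_triangle_components X
  have : IsIso (R.map (adj₂.unit.app X) ≫ adj₂.counit.app (R.obj X)) := by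
    rw [h]; exact IsIso.id _
  exact IsIso.of_isIso_comp_right _ (adj₂.counit.app (R.obj X))

theorem isIso_map_counit (X : A) : IsIso (R.map (adj₁.counit.app X)) := by
  have h := adj₁.right_triangle_components X
  have : IsIso (adj₁.unit.app (R.obj X) ≫ R.map (adj₁.counit.app X)) := by
    rw [h]; exact IsIso.id _
  exact IsIso.of_isIso_comp_left (adj₁.unit.app (R.obj X)) _

end

variable {A : Type u₁} [Category.{v} A] [Abelian A] {B : Type u₂} [Category.{v'} B] [Abelian B]
  {J : B ⥤ A} {R : A ⥤ B} {E : B ⥤ A} (adj₁ : J ⊣ R) (adj₂ : R ⊣ E)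

theorem isZero_map_kernel (R : A ⥤ B) [R.Additive] [PreservesFiniteLimits R] {X Y : A} (f : X ⟶ Y)
    [Mono (R.map f)] : IsZero (R.obj (kernel f)) := by
  refine IsZero.of_mono_eq_zero (R.map (kernel.ι f)) ?_
  rw [← cancel_mono (R.map f), ← R.map_comp]
  simp

theorem isZero_map_cokernel (R : A ⥤ B) [R.Additive] [PreservesFiniteColimits R] {X Y : A}
    (f : X ⟶ Y) [Epi (R.map f)] : IsZero (R.obj (cokernel f)) := by
  refine IsZero.of_epi_eq_zero (R.map (cokernel.π f)) ?_
  rw [← cancel_epi (R.map f), ← R.map_comp]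
  simp

section

variable [IsIso adj₁.unit] [R.Additive] [PreservesFiniteLimits R] [PreservesFiniteColimits R]

variable [HasExt.{w} A] [HasExt.{w'} B] [EnoughProjectives A] [E.PreservesEpimorphisms]

include adj₁ adj₂ in
-- By adjunction the target becomes `Ext X (E (R Y))`. The unit `Y ⟶ E (R Y)` has kernel and
-- cokernel killed by `R`, hence injective, so vanishing passes from `Y` to `E (R Y)`.
theorem subsingleton_ext_map_of_injective
    (hinj : ∀ Q : A, IsZero (R.obj Q) → Injective Q) {X Y : A} {n : ℕ}
    (h : Subsingleton (Ext.{w} X Y (n + 1))) :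
    Subsingleton (Ext.{w'} (R.obj X) (R.obj Y) (n + 1)) := by
  rw [subsingleton_ext_adjoint_iff adj₂]
  have := isIso_map_unit adj₁ adj₂ Y
  have := hinj _ (isZero_map_kernel R (adj₂.unit.app Y))
  have := hinj _ (isZero_map_cokernel R (adj₂.unit.app Y))
  exact subsingleton_ext_of_injective_ker_coker (adj₂.unit.app Y) h

include adj₁ adj₂ in
-- By adjunction the target becomes `Ext (R (E M)) N`, and `R (E M) ≅ M`.
theorem subsingleton_ext_map_rightAdjoint {M N : B} {n : ℕ}
    (h : Subsingleton (Ext.{w'} M N (n + 1))) :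
    Subsingleton (Ext.{w} (E.obj M) (E.obj N) (n + 1)) := by
  rw [← subsingleton_ext_adjoint_iff adj₂]
  have := isIso_counit_of_isIso_unit adj₁ adj₂
  let e : R.obj (E.obj M) ≅ M := asIso (adj₂.counit.app M)
  refine subsingleton_of_forall_eq 0 fun x => ?_
  have hx : (Ext.mk₀ e.hom).comp ((Ext.mk₀ e.inv).comp x (zero_add _)) (zero_add _) = x := by
    rw [Ext.mk₀_comp_mk₀_assoc, e.hom_inv_id, Ext.mk₀_id_comp]
  rw [← hx, Subsingleton.elim ((Ext.mk₀ e.inv).comp x (zero_add _)) 0, Ext.comp_zero]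

end

section

variable [IsIso adj₁.unit] [EnoughProjectives B] [J.Additive] [PreservesFiniteLimits J]
  [R.Additive] [PreservesFiniteLimits R] [PreservesFiniteColimits R]

include adj₁ in
/-- The projective dimension of `X` is bounded in terms of that of `R X`, if the objects killed
by `R` have projective dimension at most one. -/
theorem exists_hasProjectiveDimensionLE
    (hpd : ∀ Q : A, IsZero (R.obj Q) → HasProjectiveDimensionLT Q 2)
    (hmono : ∀ X, Mono (adj₁.counit.app X)) (X : A) (n : ℕ)
    [HasProjectiveDimensionLT (R.obj X) (n + 1)] : HasProjectiveDimensionLT X (n + 2) := by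
  have := adj₁.leftAdjoint_preservesColimits
  have this_J : HasProjectiveDimensionLT (J.obj (R.obj X)) (n + 1) :=
    hasProjectiveDimensionLT_leftAdjoint adj₁ n _
  have := isIso_map_counit adj₁ X
  have hQ := hpd _ (isZero_map_cokernel R (adj₁.counit.app X))
  -- In `0 → J R X → X → Q → 0` the ends have projective dimension at most `n` and at most `1`; both
  -- are at most `n + 1`.
  refine (shortExact_cokernel (adj₁.counit.app X)).hasProjectiveDimensionLT_X₂ (n + 2) ?_ ?_
  · exact @hasProjectiveDimensionLT_of_ge _ _ _ _ (n + 1) _ (by omega) this_J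
  · exact @hasProjectiveDimensionLT_of_ge _ _ _ _ 2 _ (by omega) hQ

end

end Triple

end Abstract

/-! ### Pointwise exactness, Yoneda lemma and projectives in module categories -/

section ModCatBasics

variable {C : Type u} [Category.{u} C] [Preadditive C]

instance : PreservesFiniteLimits (AdditiveFunctor.forget C AddCommGrpCat.{u}) := by
  have := (additiveFunctor C AddCommGrpCat.{u}).preservesKernels_ι
  exact Functor.preservesFiniteLimits_of_preservesKernels _

instance : PreservesFiniteColimits (AdditiveFunctor.forget C AddCommGrpCat.{u}) := by
  have := (additiveFunctor C AddCommGrpCat.{u}).preservesCokernels_ι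
  exact Functor.preservesFiniteColimits_of_preservesCokernels _

theorem ModCat.mono_iff {F G : ModCat C} (f : F ⟶ G) :
    Mono f ↔ ∀ X, Function.Injective (f.hom.app X) := by
  rw [← (AdditiveFunctor.forget C AddCommGrpCat.{u}).mono_map_iff_mono f,
    NatTrans.mono_iff_mono_app]
  exact forall_congr' fun X => AddCommGrpCat.mono_iff_injective _

theorem ModCat.epi_iff {F G : ModCat C} (f : F ⟶ G) :
    Epi f ↔ ∀ X, Function.Surjective (f.hom.app X) := by
  rw [← (AdditiveFunctor.forget C AddCommGrpCat.{u}).epi_map_iff_epi f,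
    NatTrans.epi_iff_epi_app]
  exact forall_congr' fun X => AddCommGrpCat.epi_iff_surjective _

theorem ModCat.exists_of_exact {S : ShortComplex (ModCat C)} (hS : S.Exact) {X : C}
    (x : S.X₂.obj.obj X) (hx : S.g.hom.app X x = 0) : ∃ y, S.f.hom.app X y = x := by
  have := hS.map (AdditiveFunctor.forget C AddCommGrpCat.{u} ⋙ (evaluation _ _).obj X)
  rw [ShortComplex.ab_exact_iff] at this
  exact this x hx

theorem ModCat.map_zero_apply (F : ModCat C) {X Y : C} (x : F.obj.obj X) :
    F.obj.map (0 : X ⟶ Y) x = 0 := by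
  rw [F.obj.map_zero]; rfl

theorem ModCat.map_add_apply (F : ModCat C) {X Y : C} (f g : X ⟶ Y) (x : F.obj.obj X) :
    F.obj.map (f + g) x = F.obj.map f x + F.obj.map g x := by
  rw [F.obj.map_add]; rfl

theorem ModCat.map_sum_apply (F : ModCat C) {X Y : C} {ι : Type*} (s : Finset ι) (f : ι → (X ⟶ Y))
    (x : F.obj.obj X) : F.obj.map (∑ i ∈ s, f i) x = ∑ i ∈ s, F.obj.map (f i) x := by
  classical
  induction s using Finset.induction_on with
  | empty => simp
  | insert a s ha ih => rw [Finset.sum_insert ha, Finset.sum_insert ha, map_add_apply, ih]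

theorem ModCat.map_comp_apply (F : ModCat C) {X Y Z : C} (f : X ⟶ Y) (g : Y ⟶ Z)
    (x : F.obj.obj X) : F.obj.map (f ≫ g) x = F.obj.map g (F.obj.map f x) := by
  rw [F.obj.map_comp]; rfl

theorem ModCat.map_id_apply (F : ModCat C) {X : C} (x : F.obj.obj X) :
    F.obj.map (𝟙 X) x = x := by
  rw [F.obj.map_id]; rfl

theorem ModCat.naturality_apply {F G : ModCat C} (α : F ⟶ G) {X Y : C} (f : X ⟶ Y)
    (x : F.obj.obj X) : α.hom.app Y (F.obj.map f x) = G.obj.map f (α.hom.app X x) :=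
  ConcreteCategory.congr_hom (α.hom.naturality f) x

theorem ModCat.hom_ext {F G : ModCat C} {α β : F ⟶ G}
    (h : ∀ X (x : F.obj.obj X), α.hom.app X x = β.hom.app X x) : α = β := by
  apply ObjectProperty.hom_ext
  ext X x
  exact h X x

/-- The morphism `C(X,-) ⟶ F` that corresponds to an element of `F(X)`. -/
def ModCat.ofElement {F : ModCat C} {X : C} (x : F.obj.obj X) :
    (representable C).obj (op X) ⟶ F :=
  ObjectProperty.homMk
    { app := fun Y => AddCommGrpCat.ofHom (AddMonoidHom.mk' (fun f : X ⟶ Y => F.obj.map f x)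
        fun f g => F.map_add_apply f g x)
      naturality := fun Y Z g => by
        ext f
        exact F.map_comp_apply _ _ _ }

@[simp]
theorem ModCat.representable_hom_app {F : ModCat C} {X : C}
    (α : (representable C).obj (op X) ⟶ F) {Y : C} (f : X ⟶ Y) :
    α.hom.app Y f = F.obj.map f (α.hom.app X (𝟙 X : X ⟶ X)) := by
  refine Eq.trans ?_ (ModCat.naturality_apply α f (𝟙 X : X ⟶ X))
  exact congrArg (α.hom.app Y) (Category.id_comp f).symm

theorem ModCat.ofElement_eq {F : ModCat C} {X : C} (α : (representable C).obj (op X) ⟶ F) :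
    ModCat.ofElement (α.hom.app X (𝟙 X : X ⟶ X)) = α :=
  ModCat.hom_ext fun _ f => (ModCat.representable_hom_app α f).symm

theorem ModCat.ofElement_comp {F G : ModCat C} {X : C} (x : F.obj.obj X) (α : F ⟶ G) :
    ModCat.ofElement x ≫ α = ModCat.ofElement (α.hom.app X x) :=
  ModCat.hom_ext fun _ _ => ModCat.naturality_apply α _ _

instance (X : Cᵒᵖ) : Projective ((representable C).obj X) where
  factors {E F} f e he := by
    obtain ⟨y, hy⟩ := (ModCat.epi_iff e).1 he _ (f.hom.app X.unop (𝟙 X.unop : X.unop ⟶ X.unop))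
    refine ⟨ModCat.ofElement y, ?_⟩
    rw [ModCat.ofElement_comp, hy]
    exact ModCat.ofElement_eq (X := X.unop) f

/-- Closure under coproducts indexed by arbitrary small types is needed to cover a module by one
representable functor for each of its elements. -/
instance (J : Type u) :
    (additiveFunctor C AddCommGrpCat.{u}).IsClosedUnderColimitsOfShape (Discrete J) where
  colimitsOfShape_le := by
    rintro F ⟨p⟩
    refine ⟨fun {X Y f g} => ?_⟩
    refine (isColimitOfPreserves ((evaluation C AddCommGrpCat.{u}).obj X) p.isColimit).hom_ext
      fun j => ?_
    have : (p.diag.obj j).Additive := p.prop_diag_obj j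
    let α : p.diag.obj j ⟶ F := p.ι.app j
    change α.app X ≫ F.map (f + g) = α.app X ≫ (F.map f + F.map g)
    simp only [Preadditive.comp_add, ← α.naturality, (p.diag.obj j).map_add,
      Preadditive.add_comp]

instance : EnoughProjectives (ModCat C) where
  presentation F := by
    let P : (Σ X : C, F.obj.obj X) → ModCat C := fun x => (representable C).obj (op x.1)
    let π : ∐ P ⟶ F := Sigma.desc fun x => ModCat.ofElement x.2
    have : Epi π := by
      rw [ModCat.epi_iff]
      intro X x
      refine ⟨(Sigma.ι P ⟨X, x⟩).hom.app X (𝟙 X : X ⟶ X), ?_⟩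
      change (Sigma.ι P ⟨X, x⟩ ≫ π).hom.app X (𝟙 X : X ⟶ X) = x
      rw [Sigma.ι_desc]
      exact F.map_id_apply x
    exact ⟨{ p := ∐ P, f := π }⟩

end ModCatBasics

/-! ### Restriction and extension along an additive functor -/

section Restrict

variable {A B : Type u} [Category.{u} A] [Preadditive A] [Category.{u} B] [Preadditive B]

instance (i : A ⥤ B) [i.Additive] : PreservesFiniteLimits (restrictAlong i) := by
  have : PreservesFiniteLimits (restrictAlong i ⋙ AdditiveFunctor.forget A AddCommGrpCat.{u}) :=
    inferInstanceAs (PreservesFiniteLimits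
      (AdditiveFunctor.forget B AddCommGrpCat.{u} ⋙ (Functor.whiskeringLeft _ _ _).obj i))
  exact preservesFiniteLimits_of_reflects_of_preserves (restrictAlong i)
    (AdditiveFunctor.forget A AddCommGrpCat.{u})

instance (i : A ⥤ B) [i.Additive] : PreservesFiniteColimits (restrictAlong i) := by
  have : PreservesFiniteColimits (restrictAlong i ⋙ AdditiveFunctor.forget A AddCommGrpCat.{u}) :=
    inferInstanceAs (PreservesFiniteColimits
      (AdditiveFunctor.forget B AddCommGrpCat.{u} ⋙ (Functor.whiskeringLeft _ _ _).obj i))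
  exact preservesFiniteColimits_of_reflects_of_preserves (restrictAlong i)
    (AdditiveFunctor.forget A AddCommGrpCat.{u})

/-- An adjunction `i ⊣ p` induces an adjunction `p^* ⊣ i^*` between the restriction functors. -/
def restrictAlongAdjunction {i : A ⥤ B} {p : B ⥤ A} [i.Additive] [p.Additive] (adj : i ⊣ p) :
    restrictAlong p ⊣ restrictAlong i :=
  Adjunction.mkOfUnitCounit
    { unit :=
        { app := fun G => ObjectProperty.homMk (Functor.whiskerRight adj.unit G.obj)
          naturality := fun F G α => ModCat.hom_ext fun X x =>
            (ModCat.naturality_apply α (adj.unit.app X) x).symm }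
      counit :=
        { app := fun F => ObjectProperty.homMk (Functor.whiskerRight adj.counit F.obj)
          naturality := fun F G α => ModCat.hom_ext fun X x =>
            (ModCat.naturality_apply α (adj.counit.app X) x).symm }
      left_triangle := by
        refine NatTrans.ext (funext fun G => ModCat.hom_ext fun X x => ?_)
        change G.obj.map _ (G.obj.map _ x) = x
        refine (ModCat.map_comp_apply _ _ _ _).symm.trans ?_
        refine (congrArg (fun f => G.obj.map f x) (adj.right_triangle_components X)).trans
          (ModCat.map_id_apply G x)
      right_triangle := by
        refine NatTrans.ext (funext fun F => ModCat.hom_ext fun X x => ?_)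
        change F.obj.map _ (F.obj.map _ x) = x
        refine (ModCat.map_comp_apply _ _ _ _).symm.trans ?_
        refine (congrArg (fun f => F.obj.map f x) (adj.left_triangle_components X)).trans
          (ModCat.map_id_apply F x) }

instance (i : A ⥤ B) [i.Additive] : (extendAlong i).Additive where
  map_add {F G α β} := by
    refine ModCat.hom_ext fun X x => ?_
    exact Preadditive.comp_add _ _ _ x α β

/-- Surjectivity at `X` says that morphisms from `B(X, i -)` lift along the epimorphism. -/
theorem extendAlong_preservesEpimorphisms (i : A ⥤ B) [i.Additive]
    (h : ∀ X : B, Projective ((restrictAlong i).obj ((representable B).obj (op X)))) :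
    (extendAlong i).PreservesEpimorphisms where
  preserves {F G} α hα := by
    rw [ModCat.epi_iff]
    intro X φ
    let ψ : (restrictAlong i).obj ((representable B).obj (op X)) ⟶ G := φ
    exact (h X).factors ψ α

/-- Extension of modules along `i` is right adjoint to restriction along `i`. -/
def restrictExtendAdjunction (i : A ⥤ B) [i.Additive] : restrictAlong i ⊣ extendAlong i :=
  Adjunction.mkOfUnitCounit
    { unit :=
        { app := fun F => ObjectProperty.homMk
            { app := fun X => AddCommGrpCat.ofHom (AddMonoidHom.mk'
                (fun x : F.obj.obj X => (restrictAlong i).map (ModCat.ofElement x))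
                fun x y => ModCat.hom_ext (C := A) fun _ f => map_add (F.obj.map f).hom x y)
              naturality := fun X Y f => by
                ext x
                exact ModCat.hom_ext (C := A) fun Z g => (ModCat.map_comp_apply F f g x).symm }
          naturality := fun F G α => ModCat.hom_ext fun X x =>
            ModCat.hom_ext (C := A) fun Z g => (ModCat.naturality_apply α g x).symm }
      counit :=
        { app := fun G => ObjectProperty.homMk
            { app := fun U => AddCommGrpCat.ofHom (AddMonoidHom.mk'
                (fun φ : (restrictAlong i).obj ((representable B).obj (op (i.obj U))) ⟶ G =>
                  φ.hom.app U (𝟙 (i.obj U) : i.obj U ⟶ i.obj U))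
                fun φ ψ => rfl)
              naturality := fun U V f => by
                ext φ
                let φ' : (restrictAlong i).obj ((representable B).obj (op (i.obj U))) ⟶ G := φ
                exact (congrArg (φ'.hom.app V) ((Category.comp_id (i.map f)).trans
                  (Category.id_comp (i.map f)).symm)).trans (ModCat.naturality_apply φ' f
                    (𝟙 (i.obj U) : i.obj U ⟶ i.obj U)) }
          naturality := fun F G α => rfl }
      left_triangle := by
        refine NatTrans.ext (funext fun F => ModCat.hom_ext fun X x => ?_)
        exact ModCat.map_id_apply F x
      right_triangle := by
        refine NatTrans.ext (funext fun G => ModCat.hom_ext fun X φ => ?_)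
        refine ModCat.hom_ext (C := A) fun U f => ?_
        let φ' : (restrictAlong i).obj ((representable B).obj (op X)) ⟶ G := φ
        exact congrArg (φ'.hom.app U) (Category.comp_id f) }

end Restrict

/-! ### Objects killed by a functor with a fully faithful left adjoint -/

section Killed

universe v v' v'' u₁ u₂ u₃

/-- The unit identifies `Q` with `r (L Q)`, and `r` preserves injectives since `L` preserves
monomorphisms. -/
theorem injective_of_isZero_obj {A : Type u₁} [Category.{v} A] {B : Type u₂} [Category.{v'} B]
    {T : Type u₃} [Category.{v''} T] {R : A ⥤ B} {L : A ⥤ T} {r : T ⥤ A} (adj' : L ⊣ r)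
    (hunit : ∀ Q, IsZero (R.obj Q) → IsIso (adj'.unit.app Q)) [L.PreservesMonomorphisms]
    (hT : ∀ W : T, Injective W) (Q : A)
    (hQ : IsZero (R.obj Q)) : Injective Q := by
  have := hunit Q hQ
  have := hT (L.obj Q)
  have : Injective (r.obj (L.obj Q)) := Injective.injective_of_adjoint adj' _
  exact Injective.of_iso (asIso (adj'.unit.app Q)).symm this

/-- Objects killed by `R` have projective dimension at most one, if they form a category in which
every object is projective. -/
theorem hasProjectiveDimensionLT_two_of_isZero_obj {A : Type u₁} [Category.{v} A] [Abelian A]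
    {B : Type u₂} [Category.{v'} B] [Abelian B] {T : Type u₃} [Category.{v''} T] [Abelian T]
    {J : B ⥤ A} {R : A ⥤ B} (adj : J ⊣ R) {L : A ⥤ T} {r : T ⥤ A} (adj' : L ⊣ r)
    (hunit : ∀ Q, IsZero (R.obj Q) → IsIso (adj'.unit.app Q)) [EnoughProjectives A] [IsIso adj.unit]
    [R.Additive] [PreservesFiniteColimits R] (hR : ∀ P, Projective P → Projective (R.obj P))
    (hmono : ∀ X, Mono (adj.counit.app X)) (hT : ∀ W : T, Projective W) (Q : A)
    (hQ : IsZero (R.obj Q)) : HasProjectiveDimensionLT Q 2 := by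
  let P := Projective.over Q
  let c : J.obj (R.obj P) ⟶ P := adj.counit.app P
  have hc : Mono c := hmono P
  have : Projective (R.obj P) := hR P inferInstance
  have hJRP : Projective (J.obj (R.obj P)) := adj.map_projective _ this
  -- By naturality this composite factors through `J (R Q)`, which is zero.
  have hcQ : c ≫ Projective.π Q = 0 := by
    refine (adj.counit.naturality (Projective.π Q)).symm.trans ?_
    have := adj.isLeftAdjoint
    rw [(J.map_isZero hQ).eq_zero_of_src (adj.counit.app Q), comp_zero]
  have := isIso_map_counit adj P
  have hP' : IsZero (R.obj (cokernel c)) := isZero_map_cokernel R (adj.counit.app P)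
  let e : cokernel c ⟶ Q := cokernel.desc c (Projective.π Q) hcQ
  have he : Epi e := by
    have : Epi (cokernel.π c ≫ e) := by rw [cokernel.π_desc]; infer_instance
    exact epi_of_epi (cokernel.π c) e
  -- The cokernel of `c` is the quotient of the projective `P` by the projective `J (R P)`.
  have hpd : HasProjectiveDimensionLT (cokernel c) 2 :=
    (shortExact_cokernel c).hasProjectiveDimensionLT_X₃ 1
      (inferInstanceAs (HasProjectiveDimensionLT (J.obj (R.obj P)) 1))
      (inferInstanceAs (HasProjectiveDimensionLT P 2))
  have := hunit _ hQ
  have := hunit _ hP'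
  have := hT (L.obj Q)
  have := adj'.leftAdjoint_preservesColimits
  -- The epimorphism `e` splits after applying `L`. The units are isomorphisms at both of its ends,
  -- so the splitting carries back and `Q` is a retract of `cokernel c`.
  let σ : L.obj Q ⟶ L.obj (cokernel c) := Projective.factorThru (𝟙 _) (L.map e)
  have hσ : σ ≫ L.map e = 𝟙 _ := Projective.factorThru_comp _ _
  have hret : Retract Q (cokernel c) :=
    { i := adj'.unit.app Q ≫ r.map σ ≫ inv (adj'.unit.app (cokernel c))
      r := e
      retract := by
        have h := adj'.unit.naturality e
        dsimp at h
        rw [← cancel_mono (adj'.unit.app Q)]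
        simp only [Category.assoc, Category.id_comp]
        rw [h, IsIso.inv_hom_id_assoc, ← r.map_comp, hσ, r.map_id]
        exact Category.comp_id _ }
  exact hret.hasProjectiveDimensionLT 2

end Killed

/-! ### Finitely generated and finitely presented modules -/

section FinitelyPresented

/-- Every finite family of objects has a weak coproduct. -/
def HasWeakFiniteCoproducts (C : Type u) [Category.{u} C] : Prop :=
  ∀ (κ : Type) [Fintype κ] (X : κ → C), ∃ (Z : C) (ι : ∀ k, X k ⟶ Z),
    ∀ (Y : C) (f : ∀ k, X k ⟶ Y), ∃ g : Z ⟶ Y, ∀ k, ι k ≫ g = f k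

variable {C : Type u} [Category.{u} C] [Preadditive C]

theorem isFG_iff {F : ModCat C} : IsFG F ↔
    ∃ (X : C) (x : F.obj.obj X), ∀ (Y : C) (y : F.obj.obj Y), ∃ f : X ⟶ Y, F.obj.map f x = y := by
  constructor
  · rintro ⟨X, p, hp⟩
    refine ⟨X, p.hom.app X (𝟙 X : X ⟶ X), fun Y y => ?_⟩
    obtain ⟨f, hf⟩ := (ModCat.epi_iff p).1 hp Y y
    exact ⟨f, (ModCat.representable_hom_app p f).symm.trans hf⟩
  · rintro ⟨X, x, h⟩
    exact ⟨X, ModCat.ofElement x, (ModCat.epi_iff _).2 fun Y y => h Y y⟩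

theorem isFG_representable (X : C) : IsFG ((representable C).obj (op X)) :=
  ⟨X, 𝟙 _, inferInstance⟩

theorem IsFG.of_epi {F G : ModCat C} (hF : IsFG F) (α : F ⟶ G) [Epi α] : IsFG G := by
  obtain ⟨X, p, hp⟩ := hF
  exact ⟨X, p ≫ α, epi_comp _ _⟩

/-- Finitely many elements that generate `F` on the elements satisfying `P` can be replaced by
a single one. -/
theorem exists_generator_of_family (hC : HasWeakFiniteCoproducts C) {F : ModCat C} {κ : Type}
    [Fintype κ] (X : κ → C) (x : ∀ k, F.obj.obj (X k)) :
    ∃ (Z : C) (ι : ∀ k, X k ⟶ Z) (z : F.obj.obj Z), z = ∑ k, F.obj.map (ι k) (x k) ∧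
      ∀ (Y : C) (f : ∀ k, X k ⟶ Y), ∃ g : Z ⟶ Y, F.obj.map g z = ∑ k, F.obj.map (f k) (x k) := by
  obtain ⟨Z, ι, h⟩ := hC κ X
  refine ⟨Z, ι, _, rfl, fun Y f => ?_⟩
  obtain ⟨g, hg⟩ := h Y f
  refine ⟨g, ?_⟩
  rw [map_sum]
  exact Finset.sum_congr rfl fun k _ => by rw [← hg k, ModCat.map_comp_apply]

theorem isFG_of_family (hC : HasWeakFiniteCoproducts C) {F : ModCat C} {κ : Type}
    [Fintype κ] (X : κ → C) (x : ∀ k, F.obj.obj (X k))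
    (h : ∀ (Y : C) (y : F.obj.obj Y), ∃ f : ∀ k, X k ⟶ Y, ∑ k, F.obj.map (f k) (x k) = y) :
    IsFG F := by
  obtain ⟨Z, -, z, -, hz⟩ := exists_generator_of_family hC X x
  refine isFG_iff.2 ⟨Z, z, fun Y y => ?_⟩
  obtain ⟨f, rfl⟩ := h Y y
  exact hz Y f

/-- Two elements can be replaced by one that generates the same submodule. -/
theorem exists_generator_pair (hC : HasWeakFiniteCoproducts C) {F : ModCat C} {X X' : C}
    (x : F.obj.obj X) (x' : F.obj.obj X') :
    ∃ (Z : C) (ι : X ⟶ Z) (ι' : X' ⟶ Z) (z : F.obj.obj Z),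
      z = F.obj.map ι x + F.obj.map ι' x' ∧
      ∀ (Y : C) (f : X ⟶ Y) (f' : X' ⟶ Y), ∃ g : Z ⟶ Y,
        F.obj.map g z = F.obj.map f x + F.obj.map f' x' := by
  let X₂ : Bool → C := fun b => Bool.rec X' X b
  obtain ⟨Z, ι, z, hz, h⟩ := exists_generator_of_family hC X₂
    (fun b => Bool.rec x' x b : ∀ b, F.obj.obj (X₂ b))
  refine ⟨Z, ι true, ι false, z, by rw [hz, Fintype.sum_bool], fun Y f f' => ?_⟩
  obtain ⟨g, hg⟩ := h Y (fun b => Bool.rec f' f b)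
  exact ⟨g, by rw [hg, Fintype.sum_bool]⟩

/-- The presenting projective `P₁` is traded for one element generating the kernel, which reduces
the closure properties below to computations with generators. -/
theorem isFP_iff {F : ModCat C} : IsFP F ↔ ∃ (P : ModCat C) (p : P ⟶ F), Projective P ∧ IsFG P ∧
    Epi p ∧ ∃ (X : C) (x : P.obj.obj X), p.hom.app X x = 0 ∧
      ∀ (Y : C) (y : P.obj.obj Y), p.hom.app Y y = 0 → ∃ f : X ⟶ Y, P.obj.map f x = y := by
  constructor
  · rintro ⟨P₁, P₀, d, p, w, h₁, h₁', h₀, h₀', hex, hp⟩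
    refine ⟨P₀, p, h₀, h₀', hp, ?_⟩
    obtain ⟨X, x, hx⟩ := isFG_iff.1 h₁'
    refine ⟨X, d.hom.app X x, ?_, fun Y y hy => ?_⟩
    · change (d ≫ p).hom.app X x = 0
      rw [w]; rfl
    · obtain ⟨z, hz⟩ := ModCat.exists_of_exact hex y hy
      obtain ⟨f, rfl⟩ := hx Y z
      exact ⟨f, (ModCat.naturality_apply d f x).symm.trans hz⟩
  · rintro ⟨P, p, hP, hP', hp, X, x, hx, h⟩
    have w : ModCat.ofElement x ≫ p = 0 := by
      rw [ModCat.ofElement_comp, hx]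
      exact ModCat.hom_ext fun Y f => map_zero (F.obj.map f).hom
    refine ⟨_, P, ModCat.ofElement x, p, w, inferInstance, isFG_representable X, hP, hP', ?_, hp⟩
    rw [ShortComplex.exact_iff_epi_kernel_lift, ModCat.epi_iff]
    intro Y y
    obtain ⟨f, hf⟩ := h Y ((kernel.ι p).hom.app Y y)
      (congrArg (fun α : kernel p ⟶ F => α.hom.app Y y) (kernel.condition p))
    refine ⟨f, (ModCat.mono_iff (kernel.ι p)).1 inferInstance Y (Eq.trans ?_ hf)⟩
    exact congrArg (fun α : (representable C).obj (op X) ⟶ P => α.hom.app Y f)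
      (kernel.lift_ι p (ModCat.ofElement x) w)

theorem IsFP.isFG {F : ModCat C} (hF : IsFP F) : IsFG F := by
  obtain ⟨P, p, -, hP, hp, -⟩ := isFP_iff.1 hF
  exact hP.of_epi p

theorem isFP_of_projective {P : ModCat C} [Projective P] (hP : IsFG P) : IsFP P := by
  obtain ⟨X, x, hx⟩ := isFG_iff.1 hP
  refine isFP_iff.2 ⟨P, 𝟙 P, inferInstance, hP, inferInstance, X, 0, rfl, fun Y y hy => ⟨0, ?_⟩⟩
  rw [map_zero]
  exact hy.symm

/-- A quotient of a finitely presented module by a finitely generated submodule is finitely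
presented. -/
theorem IsFP.of_epi (hC : HasWeakFiniteCoproducts C) {F G : ModCat C} (hG : IsFP G) (q : G ⟶ F)
    [Epi q] {X : C} (c : G.obj.obj X) (hc : q.hom.app X c = 0)
    (h : ∀ (Y : C) (y : G.obj.obj Y), q.hom.app Y y = 0 → ∃ f : X ⟶ Y, G.obj.map f c = y) :
    IsFP F := by
  obtain ⟨P, p, hP, hP', hp, X', x', hx', h'⟩ := isFP_iff.1 hG
  obtain ⟨b, rfl⟩ := (ModCat.epi_iff p).1 hp X c
  -- The kernel of `p ≫ q` is generated by a lift `b` of `c` together with the generator `x'` of the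
  -- kernel of `p`.
  obtain ⟨Z, ι, ι', z, hz', hz⟩ := exists_generator_pair hC b x'
  refine isFP_iff.2 ⟨P, p ≫ q, hP, hP', epi_comp _ _, Z, z, ?_, fun Y y hy => ?_⟩
  · change q.hom.app Z (p.hom.app Z _) = 0
    rw [hz', map_add, ModCat.naturality_apply, ModCat.naturality_apply, hx', map_zero, add_zero,
      ModCat.naturality_apply, hc, map_zero]
  · obtain ⟨f, hf⟩ := h Y (p.hom.app Y y) hy
    obtain ⟨f', hf'⟩ := h' Y (y - P.obj.map f b) (by
      rw [map_sub, ModCat.naturality_apply, hf, sub_self])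
    obtain ⟨g, hg⟩ := hz Y f f'
    exact ⟨g, by rw [hg, hf', add_sub_cancel]⟩

theorem IsFP.of_retract (hC : HasWeakFiniteCoproducts C) {F G : ModCat C} (hG : IsFP G)
    (ρ : Retract F G) : IsFP F := by
  obtain ⟨X, x, hx⟩ := isFG_iff.1 hG.isFG
  have hρ : ∀ (Y : C) (y : F.obj.obj Y), ρ.r.hom.app Y (ρ.i.hom.app Y y) = y := fun Y y =>
    congrArg (fun α : F ⟶ F => α.hom.app Y y) ρ.retract
  have : Epi ρ.r := (ModCat.epi_iff _).2 fun Y y => ⟨_, hρ Y y⟩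
  -- If `x` generates `G`, then `x - i (r x)` generates the kernel of `r`: when `y = f x` and `r y =
  -- 0`, applying `f` to it gives back `y`.
  refine hG.of_epi hC ρ.r (x - ρ.i.hom.app X (ρ.r.hom.app X x)) ?_ fun Y y hy => ?_
  · rw [map_sub, hρ, sub_self]
  · obtain ⟨f, rfl⟩ := hx Y y
    refine ⟨f, ?_⟩
    rw [map_sub, ← ModCat.naturality_apply, ← ModCat.naturality_apply, hy, map_zero, sub_zero]

/-- The horseshoe argument: covers of the two ends add up to a cover of the middle, and so do the
relations, once those of the quotient are corrected by elements of `P`. -/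
theorem IsFP.of_shortExact (hC : HasWeakFiniteCoproducts C) {S : ShortComplex (ModCat C)}
    (hS : S.ShortExact) (h₁ : IsFP S.X₁) (h₃ : IsFP S.X₃) : IsFP S.X₂ := by
  obtain ⟨P, p, hP, hP', hp, X, x, hx, h⟩ := isFP_iff.1 h₁
  obtain ⟨P', p', hQ, hQ', hp', X', x', hx', h'⟩ := isFP_iff.1 h₃
  have := hS.epi_g
  have hf := (ModCat.mono_iff S.f).1 hS.mono_f
  have hgf : ∀ (Y : C) (y : S.X₁.obj.obj Y), S.g.hom.app Y (S.f.hom.app Y y) = 0 := fun Y y =>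
    congrArg (fun α : S.X₁ ⟶ S.X₃ => α.hom.app Y y) S.zero
  let l : P' ⟶ S.X₂ := Projective.factorThru p' S.g
  have hl : ∀ (Y : C) (y : P'.obj.obj Y), S.g.hom.app Y (l.hom.app Y y) = p'.hom.app Y y :=
    fun Y y => congrArg (fun α : P' ⟶ S.X₃ => α.hom.app Y y) (Projective.factorThru_comp p' S.g)
  let π : P ⊞ P' ⟶ S.X₂ := biprod.desc (p ≫ S.f) l
  have hπ : ∀ (Y : C) (a : P.obj.obj Y) (b : P'.obj.obj Y), π.hom.app Y
      ((biprod.inl : P ⟶ P ⊞ P').hom.app Y a + (biprod.inr : P' ⟶ P ⊞ P').hom.app Y b) =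
        S.f.hom.app Y (p.hom.app Y a) + l.hom.app Y b := fun Y a b => by
    rw [map_add]
    congr 1
    · exact congrArg (fun α : P ⟶ S.X₂ => α.hom.app Y a) (biprod.inl_desc (p ≫ S.f) l)
    · exact congrArg (fun α : P' ⟶ S.X₂ => α.hom.app Y b) (biprod.inr_desc (p ≫ S.f) l)
  have hdec : ∀ (Y : C) (y : (P ⊞ P').obj.obj Y), ∃ a b,
      (biprod.inl : P ⟶ P ⊞ P').hom.app Y a + (biprod.inr : P' ⟶ P ⊞ P').hom.app Y b = y :=
    fun Y y => ⟨(biprod.fst : P ⊞ P' ⟶ P).hom.app Y y, (biprod.snd : P ⊞ P' ⟶ P').hom.app Y y,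
      congrArg (fun α : P ⊞ P' ⟶ P ⊞ P' => α.hom.app Y y) biprod.total⟩
  have hepi : Epi π := by
    refine (ModCat.epi_iff _).2 fun Y y => ?_
    obtain ⟨b, hb⟩ := (ModCat.epi_iff p').1 hp' Y (S.g.hom.app Y y)
    obtain ⟨c, hc⟩ := ModCat.exists_of_exact hS.exact (y - l.hom.app Y b) (by
      rw [map_sub, hl, hb, sub_self])
    obtain ⟨a, rfl⟩ := (ModCat.epi_iff p).1 hp Y c
    exact ⟨_, (hπ Y a b).trans (by rw [hc, sub_add_cancel])⟩
  have hfg : IsFG (P ⊞ P') := by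
    obtain ⟨W, w, hw⟩ := isFG_iff.1 hP'
    obtain ⟨W', w', hw'⟩ := isFG_iff.1 hQ'
    obtain ⟨Z, ι, ι', z, -, hz⟩ := exists_generator_pair hC
      ((biprod.inl : P ⟶ P ⊞ P').hom.app W w) ((biprod.inr : P' ⟶ P ⊞ P').hom.app W' w')
    refine isFG_iff.2 ⟨Z, z, fun Y y => ?_⟩
    obtain ⟨a, b, rfl⟩ := hdec Y y
    obtain ⟨f, rfl⟩ := hw Y a
    obtain ⟨f', rfl⟩ := hw' Y b
    obtain ⟨g, hg⟩ := hz Y f f'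
    exact ⟨g, by rw [hg, ModCat.naturality_apply, ModCat.naturality_apply]⟩
  -- The relation `x'` of `S.X₃` need not vanish under `l`; its image comes from some `b` in `P`, so
  -- `(-b, x')` is a relation for `S.X₂`.
  obtain ⟨c, hc⟩ := ModCat.exists_of_exact hS.exact (l.hom.app X' x') (by rw [hl, hx'])
  obtain ⟨b, rfl⟩ := (ModCat.epi_iff p).1 hp X' c
  obtain ⟨Z, ι, ι', z, hz', hz⟩ := exists_generator_pair hC
      ((biprod.inl : P ⟶ P ⊞ P').hom.app X x)
      ((biprod.inl : P ⟶ P ⊞ P').hom.app X' (-b) + (biprod.inr : P' ⟶ P ⊞ P').hom.app X' x')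
  refine isFP_iff.2 ⟨P ⊞ P', π, inferInstance, hfg, hepi, Z, z, ?_, fun Y y hy => ?_⟩
  · have h1 : π.hom.app X ((biprod.inl : P ⟶ P ⊞ P').hom.app X x) = 0 := by
      have := hπ X x 0
      rw [map_zero, add_zero, map_zero, add_zero, hx, map_zero] at this
      exact this
    rw [hz', map_add, ModCat.naturality_apply, ModCat.naturality_apply, h1, hπ, map_neg, map_neg,
      hc, neg_add_cancel, map_zero, map_zero, add_zero]
  · obtain ⟨a, a', rfl⟩ := hdec Y y
    rw [hπ] at hy
    obtain ⟨f', rfl⟩ := h' Y a' (by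
      have := congrArg (S.g.hom.app Y) hy
      rwa [map_add, hgf, zero_add, hl, map_zero] at this)
    -- Subtracting `f'` times the relation `(-b, x')` from the given one leaves `a + f' b` in `P`, a
    -- relation for `S.X₁`.
    obtain ⟨f, hf'⟩ := h Y (a + P.obj.map f' b) (by
      apply hf Y
      rw [map_zero, ← hy, map_add, map_add, ModCat.naturality_apply, ModCat.naturality_apply, hc,
        ModCat.naturality_apply])
    obtain ⟨g, hg⟩ := hz Y f f'
    refine ⟨g, ?_⟩
    rw [hg, ← ModCat.naturality_apply, hf', map_add, map_add, map_neg, map_neg,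
      ModCat.naturality_apply, ModCat.naturality_apply]
    abel

end FinitelyPresented

/-! ### Functors that preserve finite generation and presentation. -/

section MapFP

variable {A B : Type u} [Category.{u} A] [Preadditive A] [Category.{u} B] [Preadditive B]

theorem IsFG.map {Φ : ModCat A ⥤ ModCat B} [Φ.PreservesEpimorphisms]
    (hfg : ∀ X : A, IsFG (Φ.obj ((representable A).obj (op X)))) {F : ModCat A} (hF : IsFG F) :
    IsFG (Φ.obj F) := by
  obtain ⟨X, p, hp⟩ := hF
  exact (hfg X).of_epi (Φ.map p)

theorem IsFP.map {Φ : ModCat A ⥤ ModCat B} [Φ.Additive] [PreservesFiniteColimits Φ]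
    (hfg : ∀ X : A, IsFG (Φ.obj ((representable A).obj (op X))))
    (hproj : ∀ P, Projective P → Projective (Φ.obj P)) {F : ModCat A} (hF : IsFP F) :
    IsFP (Φ.obj F) := by
  obtain ⟨P₁, P₀, d, p, w, h₁, h₁', h₀, h₀', hex, hp⟩ := hF
  refine ⟨Φ.obj P₁, Φ.obj P₀, Φ.map d, Φ.map p, by rw [← Φ.map_comp, w, Φ.map_zero],
    hproj _ h₁, h₁'.map hfg, hproj _ h₀, h₀'.map hfg, ?_, inferInstance⟩
  exact hex.map_of_epi_of_preservesCokernel Φ hp inferInstance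

end MapFP

/-! ### Modules over a category generated by one object whose endomorphisms are scalars -/

section Semisimple

variable {C : Type u} [Category.{u} C] [Preadditive C]

/-- The identity of every object is a sum of morphisms that factor through `s`. -/
def IsAdditiveGenerator (s : C) : Prop :=
  ∀ S : C, ∃ (n : ℕ) (π : Fin n → (S ⟶ s)) (ι : Fin n → (s ⟶ S)), ∑ k, π k ≫ ι k = 𝟙 S

/-- A module is determined by its value at `s` as a module over `End s`; on a general object the
extension of `r` is `∑ ι r π`. -/
theorem ModCat.exists_extension {s : C} (hs : IsAdditiveGenerator s) {F G : ModCat C}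
    (r : F.obj.obj s →+ G.obj.obj s)
    (hr : ∀ (e : s ⟶ s) x, r (F.obj.map e x) = G.obj.map e (r x)) :
    ∃ ρ : F ⟶ G, ∀ x, ρ.hom.app s x = r x := by
  choose n π ι hπι using hs
  let ρ : ∀ S, F.obj.obj S →+ G.obj.obj S := fun S =>
    ∑ k, ((G.obj.map (ι S k)).hom.comp r).comp (F.obj.map (π S k)).hom
  have hρ : ∀ S x, ρ S x = ∑ k, G.obj.map (ι S k) (r (F.obj.map (π S k) x)) := fun S x => by
    simp only [ρ, AddMonoidHom.finsetSum_apply]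
    rfl
  -- Each `v ≫ π S k` is an endomorphism of `s`, and `r` commutes with those.
  have key : ∀ S (v : s ⟶ S) (y : F.obj.obj s), ρ S (F.obj.map v y) = G.obj.map v (r y) := by
    intro S v y
    rw [hρ]
    conv_rhs => rw [← Category.comp_id v, ← hπι S, Preadditive.comp_sum, G.map_sum_apply]
    refine Finset.sum_congr rfl fun k _ => ?_
    rw [← F.map_comp_apply, hr, ← G.map_comp_apply, Category.assoc]
  have hx : ∀ S (x : F.obj.obj S), x = ∑ k, F.obj.map (ι S k) (F.obj.map (π S k) x) := by
    intro S x
    conv_lhs => rw [← F.map_id_apply x, ← hπι S, F.map_sum_apply]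
    exact Finset.sum_congr rfl fun k _ => F.map_comp_apply _ _ _
  refine ⟨ObjectProperty.homMk { app := fun S => AddCommGrpCat.ofHom (ρ S), naturality := ?_ },
    fun x => ?_⟩
  · intro S S' φ
    ext x
    change ρ S' (F.obj.map φ x) = G.obj.map φ (ρ S x)
    conv_lhs => rw [hx S x]
    rw [map_sum, map_sum, hρ, map_sum]
    refine Finset.sum_congr rfl fun k _ => ?_
    rw [← F.map_comp_apply, key, G.map_comp_apply]
  · change ρ s x = r x
    have := key s (𝟙 s) x
    rwa [F.map_id_apply, G.map_id_apply] at this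

theorem ModCat.hom_ext_of_generator {s : C} (hs : IsAdditiveGenerator s) {F G : ModCat C}
    {α β : F ⟶ G} (h : ∀ x, α.hom.app s x = β.hom.app s x) : α = β := by
  refine ModCat.hom_ext fun S x => ?_
  obtain ⟨n, π, ι, hπι⟩ := hs S
  rw [← F.map_id_apply x, ← hπι, F.map_sum_apply, map_sum, map_sum]
  refine Finset.sum_congr rfl fun k _ => ?_
  rw [F.map_comp_apply, ModCat.naturality_apply α, h, ← ModCat.naturality_apply β]

variable {K : Type u} [Field K]

/-- A ring homomorphism `K → End(s)` makes `F(s)` a `K`-vector space. -/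
abbrev ModCat.scalarModule {s : C} (κ : K →+* End s) (F : ModCat C) : Module K (F.obj.obj s) where
  smul k x := F.obj.map (κ k) x
  one_smul x := by
    change F.obj.map (κ 1) x = x
    rw [map_one]
    exact F.map_id_apply x
  mul_smul k k' x := by
    change F.obj.map (κ (k * k')) x = F.obj.map (κ k) (F.obj.map (κ k') x)
    rw [map_mul, ← F.map_comp_apply]
    rfl
  smul_zero k := map_zero (F.obj.map (κ k)).hom
  smul_add k x y := map_add (F.obj.map (κ k)).hom x y
  add_smul k k' x := by
    change F.obj.map (κ (k + k')) x = _
    rw [map_add]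
    exact F.map_add_apply _ _ _
  zero_smul x := by
    change F.obj.map (κ 0) x = 0
    rw [map_zero]
    exact F.map_zero_apply _

/-- Every monomorphism splits: at `s` it is an injection of vector spaces, and a linear retraction
there is `End s`-linear because `End s` consists of scalars. -/
theorem ModCat.injective_of_generator {s : C} (hs : IsAdditiveGenerator s) (κ : K →+* End s)
    (hκ : Function.Surjective κ) (W : ModCat C) : Injective W where
  factors {F G} g f hf := by
    let := F.scalarModule κ
    let := G.scalarModule κ
    let l : F.obj.obj s →ₗ[K] G.obj.obj s :=
      { toFun := f.hom.app s
        map_add' := map_add _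
        map_smul' := fun k x => ModCat.naturality_apply f (κ k) x }
    obtain ⟨r, hr⟩ := l.exists_leftInverse_of_injective
      (LinearMap.ker_eq_bot.2 ((ModCat.mono_iff f).1 hf s))
    obtain ⟨ρ, hρ⟩ := ModCat.exists_extension hs r.toAddMonoidHom (fun e x => by
      obtain ⟨k, rfl⟩ := hκ e
      exact r.map_smul k x)
    refine ⟨ρ ≫ g, ?_⟩
    have : f ≫ ρ = 𝟙 F := ModCat.hom_ext_of_generator hs fun x =>
      (hρ _).trans (LinearMap.congr_fun hr x)
    rw [← Category.assoc, this, Category.id_comp]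

/-- Dually, every epimorphism splits, by a linear section at `s`. -/
theorem ModCat.projective_of_generator {s : C} (hs : IsAdditiveGenerator s) (κ : K →+* End s)
    (hκ : Function.Surjective κ) (W : ModCat C) : Projective W where
  factors {F G} g f hf := by
    let := F.scalarModule κ
    let := G.scalarModule κ
    let l : F.obj.obj s →ₗ[K] G.obj.obj s :=
      { toFun := f.hom.app s
        map_add' := map_add _
        map_smul' := fun k x => ModCat.naturality_apply f (κ k) x }
    obtain ⟨r, hr⟩ := l.exists_rightInverse_of_surjective
      (LinearMap.range_eq_top.2 ((ModCat.epi_iff f).1 hf s))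
    obtain ⟨ρ, hρ⟩ := ModCat.exists_extension hs r.toAddMonoidHom (fun e x => by
      obtain ⟨k, rfl⟩ := hκ e
      exact r.map_smul k x)
    refine ⟨g ≫ ρ, ?_⟩
    have : ρ ≫ f = 𝟙 G := ModCat.hom_ext_of_generator hs fun x =>
      (congrArg (f.hom.app s) (hρ x)).trans (LinearMap.congr_fun hr x)
    rw [Category.assoc, this, Category.comp_id]

theorem isFG_of_generator {s : C} (hs : IsAdditiveGenerator s) (hC : HasWeakFiniteCoproducts C)
    {F : ModCat C} {κ : Type} [Fintype κ] (x : κ → F.obj.obj s)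
    (h : ∀ y : F.obj.obj s, ∃ f : κ → (s ⟶ s), ∑ k, F.obj.map (f k) (x k) = y) : IsFG F := by
  refine isFG_of_family hC (fun _ => s) x fun Y y => ?_
  obtain ⟨n, π, ι, hπι⟩ := hs Y
  choose f hf using fun k => h (F.obj.map (π k) y)
  refine ⟨fun l => ∑ k, f k l ≫ ι k, ?_⟩
  conv_rhs => rw [← F.map_id_apply y, ← hπι, F.map_sum_apply]
  simp only [F.map_sum_apply]
  rw [Finset.sum_comm]
  refine Finset.sum_congr rfl fun k _ => ?_
  rw [F.map_comp_apply, ← hf k, map_sum]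
  exact Finset.sum_congr rfl fun l _ => F.map_comp_apply _ _ _

end Semisimple

/-! ### Modules over triangular matrix categories -/

theorem ModCat.isIso_of_bijective {C : Type u} [Category.{u} C] [Preadditive C] {F G : ModCat C}
    (f : F ⟶ G) (h : ∀ X, Function.Bijective (f.hom.app X)) : IsIso f := by
  have : Mono f := (ModCat.mono_iff f).2 fun X => (h X).1
  have : Epi f := (ModCat.epi_iff f).2 fun X => (h X).2
  exact isIso_of_mono_of_epi f

theorem ModCat.sum_app_apply {C : Type u} [Category.{u} C] [Preadditive C] {F G : ModCat C}
    {κ : Type*} (s : Finset κ) (α : κ → (F ⟶ G)) {X : C} (x : F.obj.obj X) :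
    (∑ k ∈ s, α k).hom.app X x = ∑ k ∈ s, (α k).hom.app X x :=
  map_sum (AddMonoidHom.mk' (fun α : F ⟶ G => α.hom.app X x) fun _ _ => rfl) _ _

theorem ModCat.eq_zero_of_isZero {C : Type u} [Category.{u} C] [Preadditive C] {F : ModCat C}
    (hF : IsZero F) {X : C} (x : F.obj.obj X) : x = 0 :=
  congrArg (fun α : F ⟶ F => α.hom.app X x) ((IsZero.iff_id_eq_zero F).1 hF)

namespace TriMat

variable {C : Type u} [Category.{u} C] [Preadditive C] {T U : ObjectProperty C}

@[simp] theorem comp_h {X Y Z : TriMat T U} (φ : X ⟶ Y) (ψ : Y ⟶ Z) :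
    Hom.h (φ ≫ ψ) = φ.f.hom ≫ ψ.h + φ.h ≫ ψ.g.hom := rfl
@[simp] theorem add_h {X Y : TriMat T U} (φ ψ : X ⟶ Y) : Hom.h (φ + ψ) = φ.h + ψ.h := rfl
@[simp] theorem add_g {X Y : TriMat T U} (φ ψ : X ⟶ Y) : Hom.g (φ + ψ) = φ.g + ψ.g := rfl

theorem sum_h {X Y : TriMat T U} {κ : Type*} (s : Finset κ) (φ : κ → (X ⟶ Y)) :
    Hom.h (∑ k ∈ s, φ k : X ⟶ Y) = ∑ k ∈ s, (φ k).h :=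
  map_sum (⟨⟨fun φ => φ.h, rfl⟩, fun _ _ => rfl⟩ : (X ⟶ Y) →+ (X.t.obj ⟶ Y.u.obj)) φ s

theorem sum_g {X Y : TriMat T U} {κ : Type*} (s : Finset κ) (φ : κ → (X ⟶ Y)) :
    Hom.g (∑ k ∈ s, φ k : X ⟶ Y) = ∑ k ∈ s, (φ k).g :=
  map_sum (⟨⟨fun φ => φ.g, rfl⟩, fun _ _ => rfl⟩ : (X ⟶ Y) →+ (X.u ⟶ Y.u)) φ s

/-- The morphism `(f 0; h g)`. -/
abbrev mkHom {X Y : TriMat T U} (f : X.t ⟶ Y.t) (h : X.t.obj ⟶ Y.u.obj) (g : X.u ⟶ Y.u) : X ⟶ Y :=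
  Hom.mk f h g

variable (T U) in
/-- The projection `(T, U) ↦ U`. -/
def projU : TriMat T U ⥤ U.FullSubcategory where
  obj X := X.u
  map φ := φ.g

variable (T U) in
/-- The projection `(T, U) ↦ T`. -/
def projT : TriMat T U ⥤ T.FullSubcategory where
  obj X := X.t
  map φ := φ.f

instance : (projU T U).Additive where

instance : (projT T U).Additive where

/-- The inclusion `T ↦ (T, 0)`. -/
def inclT (z : U.FullSubcategory) (hz : IsZero z) : T.FullSubcategory ⥤ TriMat T U where
  obj X := ⟨X, z⟩
  map f := ⟨f, 0, 0⟩
  map_id _ := TriMat.hom_ext rfl rfl (hz.eq_of_src _ _)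
  map_comp _ _ := TriMat.hom_ext rfl ((isZero_obj hz).eq_of_tgt _ _) (hz.eq_of_src _ _)

instance (z : U.FullSubcategory) (hz : IsZero z) : (inclT (T := T) z hz).Additive where
  map_add := TriMat.hom_ext rfl (add_zero _).symm (add_zero _).symm

/-- The inclusion `U ↦ (0, U)` is left adjoint to the projection. -/
def inclAdjunction (z : T.FullSubcategory) (hz : IsZero z) : incl (U := U) z hz ⊣ projU T U :=
  Adjunction.mkOfUnitCounit
    { unit :=
        { app := fun X => 𝟙 X
          naturality := fun X Y f => (Category.comp_id f).trans (Category.id_comp f).symm }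
      counit :=
        { app := fun Y => mkHom (X := (incl z hz).obj Y.u) 0 0 (𝟙 Y.u)
          naturality := fun X Y f => TriMat.hom_ext (hz.eq_of_src _ _)
            ((isZero_obj hz).eq_of_src _ _) ((Category.comp_id f.g).trans
              (Category.id_comp f.g).symm) }
      left_triangle := NatTrans.ext (funext fun X => TriMat.hom_ext (hz.eq_of_src _ _)
        ((isZero_obj hz).eq_of_src _ _) (by
          change 𝟙 X ≫ 𝟙 X ≫ 𝟙 X = 𝟙 X
          simp))
      right_triangle := NatTrans.ext (funext fun X => by
          change 𝟙 X.u ≫ 𝟙 X.u ≫ 𝟙 X.u = 𝟙 X.u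
          simp) }

/-- The inclusion `T ↦ (T, 0)` is right adjoint to the projection. -/
def projTAdjunction (z : U.FullSubcategory) (hz : IsZero z) : projT T U ⊣ inclT z hz :=
  Adjunction.mkOfUnitCounit
    { unit :=
        { app := fun X => mkHom (Y := (inclT z hz).obj X.t) (𝟙 X.t) 0 0
          naturality := fun X Y f => TriMat.hom_ext ((Category.comp_id f.f).trans
            (Category.id_comp f.f).symm) ((isZero_obj hz).eq_of_tgt _ _) (hz.eq_of_tgt _ _) }
      counit :=
        { app := fun X => 𝟙 X
          naturality := fun X Y f => (Category.comp_id f).trans (Category.id_comp f).symm }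
      left_triangle := NatTrans.ext (funext fun X => by
          change 𝟙 X.t ≫ 𝟙 X.t ≫ 𝟙 X.t = 𝟙 X.t
          simp)
      right_triangle := NatTrans.ext (funext fun X => TriMat.hom_ext (by
          change 𝟙 X ≫ 𝟙 X ≫ 𝟙 X = 𝟙 X
          simp) ((isZero_obj hz).eq_of_tgt _ _) (hz.eq_of_tgt _ _)) }

section

variable (z : T.FullSubcategory) (hz : IsZero z)

/-- The projection restricts to the identity on `𝒰`, so the unit is pointwise the identity. -/
instance : IsIso (restrictAlongAdjunction (inclAdjunction (U := U) z hz)).unit := by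
  refine @NatIso.isIso_of_isIso_app _ _ _ _ _ _ _ fun F => ModCat.isIso_of_bijective _ fun X => ?_
  have : ∀ x : F.obj.obj X,
      ((restrictAlongAdjunction (inclAdjunction (U := U) z hz)).unit.app F).hom.app X x = x :=
    fun x => F.map_id_apply x
  exact ⟨fun x y h => (this x).symm.trans (h.trans (this y)), fun x => ⟨x, this x⟩⟩

/-- At `(T, U)` the counit is `F` applied to `(0, U) ⟶ (T, U)`, which is split by the projection
`(T, U) ⟶ (0, U)`. -/
theorem mono_counit (F : ModCat (TriMat T U)) :
    Mono ((restrictAlongAdjunction (inclAdjunction (U := U) z hz)).counit.app F) := by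
  refine (ModCat.mono_iff _).2 fun X => ?_
  let σ : X ⟶ (incl z hz).obj X.u := mkHom 0 0 (𝟙 X.u)
  let c : (incl z hz).obj X.u ⟶ X := mkHom 0 0 (𝟙 X.u)
  have hc : c ≫ σ = 𝟙 _ := TriMat.hom_ext (hz.eq_of_src _ _) ((isZero_obj hz).eq_of_src _ _)
    (Category.comp_id _)
  intro x y hxy
  have key : ∀ x : F.obj.obj ((incl z hz).obj X.u), F.obj.map σ (F.obj.map c x) = x := fun x => by
    rw [← F.map_comp_apply, hc, F.map_id_apply]
  have h : F.obj.map c x = F.obj.map c y := hxy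
  rw [← key x, h, key y]

/-- The identity of `(T, U)` is the sum of the idempotents through `(T, 0)` and `(0, U)`, and `Q`
vanishes on the second. -/
theorem isIso_unit_of_isZero (z' : U.FullSubcategory) (hz' : IsZero z') (Q : ModCat (TriMat T U))
    (hQ : IsZero ((restrictAlong (incl z hz)).obj Q)) :
    IsIso ((restrictAlongAdjunction (projTAdjunction (T := T) z' hz')).unit.app Q) := by
  refine ModCat.isIso_of_bijective _ fun X => ?_
  let a : X ⟶ (inclT z' hz').obj X.t := mkHom (𝟙 X.t) 0 0
  let b : (inclT z' hz').obj X.t ⟶ X := mkHom (𝟙 X.t) 0 0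
  let σ : X ⟶ (incl z hz).obj X.u := mkHom 0 0 (𝟙 X.u)
  let c : (incl z hz).obj X.u ⟶ X := mkHom 0 0 (𝟙 X.u)
  have hba : b ≫ a = 𝟙 _ := TriMat.hom_ext (Category.comp_id _) ((isZero_obj hz').eq_of_tgt _ _)
    (hz'.eq_of_src _ _)
  have hab : a ≫ b + σ ≫ c = 𝟙 X := by
    refine TriMat.hom_ext ?_ ?_ ?_
    · change 𝟙 X.t ≫ 𝟙 X.t + 0 ≫ 0 = 𝟙 X.t
      simp
    · change ((𝟙 X.t : X.t ⟶ X.t).hom ≫ 0 + 0 ≫ (0 : z' ⟶ X.u).hom) +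
        ((0 : X.t ⟶ z).hom ≫ 0 + 0 ≫ (𝟙 X.u : X.u ⟶ X.u).hom) = 0
      simp
    · change 0 ≫ 0 + 𝟙 X.u ≫ 𝟙 X.u = 𝟙 X.u
      simp
  have h₁ : ∀ x, Q.obj.map a (Q.obj.map b x) = x := fun x => by
    rw [← Q.map_comp_apply, hba, Q.map_id_apply]
  have h₂ : ∀ x, Q.obj.map b (Q.obj.map a x) = x := fun x => by
    have h0 : Q.obj.map σ x = 0 :=
      ModCat.eq_zero_of_isZero hQ (X := X.u) (Q.obj.map σ x)
    have := Q.map_id_apply x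
    rwa [← hab, Q.map_add_apply, Q.map_comp_apply, Q.map_comp_apply, h0, map_zero,
      add_zero] at this
  exact ⟨fun x y h => (h₂ x).symm.trans ((congrArg (Q.obj.map b) h).trans (h₂ y)),
    fun x => ⟨Q.obj.map b x, h₁ x⟩⟩

theorem isFG_projU_representable (z : T.FullSubcategory) (hz : IsZero z) (X : U.FullSubcategory) :
    IsFG ((restrictAlong (projU T U)).obj ((representable _).obj (op X))) := by
  refine isFG_iff.2 ⟨(incl z hz).obj X, 𝟙 X, fun Y g => ⟨mkHom 0 0 g, ?_⟩⟩
  exact Category.id_comp g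

/-- The condition on `𝒯` tests against all objects of `C`, because the entries `h` go from `𝒯` to
`𝒰`. -/
theorem hasWeakFiniteCoproducts
    (hU : HasWeakFiniteCoproducts U.FullSubcategory)
    (hT : ∀ (κ : Type) [Fintype κ] (X : κ → T.FullSubcategory),
      ∃ (Z : T.FullSubcategory) (ι : ∀ k, X k ⟶ Z), ∀ (Y : C) (f : ∀ k, (X k).obj ⟶ Y),
        ∃ g : Z.obj ⟶ Y, ∀ k, (ι k).hom ≫ g = f k) :
    HasWeakFiniteCoproducts (TriMat T U) := by
  intro κ _ X
  obtain ⟨Z, ι, h⟩ := hT κ fun k => (X k).t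
  obtain ⟨Z', ι', h'⟩ := hU κ fun k => (X k).u
  refine ⟨⟨Z, Z'⟩, fun k => mkHom (ι k) 0 (ι' k), fun Y φ => ?_⟩
  obtain ⟨f, hf⟩ := h Y.t.obj fun k => (φ k).f.hom
  obtain ⟨g, hg⟩ := h Y.u.obj fun k => (φ k).h
  obtain ⟨g', hg'⟩ := h' Y.u fun k => (φ k).g
  refine ⟨mkHom (ObjectProperty.homMk f) g g', fun k => TriMat.hom_ext ?_ ?_ ?_⟩
  · exact ObjectProperty.hom_ext _ (hf k)
  · simp [hg]
  · exact hg' k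

/-- Every morphism from `t` to an object of `𝒰` factors through `z`. -/
def IsWeakReflection {t : T.FullSubcategory} {Z : U.FullSubcategory} (z : t.obj ⟶ Z.obj) : Prop :=
  ∀ (Y : U.FullSubcategory) (h : t.obj ⟶ Y.obj), ∃ g : Z ⟶ Y, z ≫ g.hom = h

/-- Two elements generate: `w` accounts for the entries `h`, and the identity of `X.u` for the
entries `g`. -/
theorem isFG_restrict_representable (hU : HasWeakFiniteCoproducts U.FullSubcategory)
    (X : TriMat T U) {Z : U.FullSubcategory} (w : X.t.obj ⟶ Z.obj) (hw : IsWeakReflection w) :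
    IsFG ((restrictAlong (incl z hz)).obj ((representable _).obj (op X))) := by
  let F := (restrictAlong (incl (U := U) z hz)).obj ((representable _).obj (op X))
  let x₁ : F.obj.obj Z := mkHom (X := X) (Y := (incl z hz).obj Z) 0 w 0
  let x₂ : F.obj.obj X.u := mkHom (X := X) (Y := (incl z hz).obj X.u) 0 0 (𝟙 _)
  obtain ⟨Z', -, -, x, -, hx⟩ := exists_generator_pair hU x₁ x₂
  refine isFG_iff.2 ⟨Z', x, fun Y φ => ?_⟩
  let φ' : X ⟶ (incl z hz).obj Y := φ
  let h' : X.t.obj ⟶ Y.obj := φ'.h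
  let g' : X.u ⟶ Y := φ'.g
  obtain ⟨f, hf⟩ := hw Y h'
  obtain ⟨g, hg⟩ := hx Y f g'
  refine ⟨g, hg.trans ?_⟩
  refine TriMat.hom_ext (hz.eq_of_tgt _ _) ?_ ?_
  · have : ((0 : X.t ⟶ z).hom ≫ (0 : z.obj ⟶ Y.obj) + w ≫ f.hom) +
        ((0 : X.t ⟶ z).hom ≫ (0 : z.obj ⟶ Y.obj) + (0 : X.t.obj ⟶ X.u.obj) ≫ g'.hom) = h' := by
      rw [hf]
      simp
    exact this
  · have : (0 : X.u ⟶ Z) ≫ f + 𝟙 X.u ≫ g' = g' := by simp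
    exact this

/-- The module `C(s,-)|_𝒰`. -/
abbrev bimodule (U : ObjectProperty C) (s : C) : ModCat U.FullSubcategory :=
  (restrictAlong U.ι).obj ((representable C).obj (op s))

/-- Since `X.t` is a summand of a sum of `n` copies of `s`, the module is a summand of `C(s,-)|_𝒰 ^
n ⊕ 𝒰(X.u,-)`. The maps `a`, `c` into the summands and `b`, `d` back exhibit this. -/
theorem projective_restrict_representable {s : T.FullSubcategory} (hs : IsAdditiveGenerator s)
    [Projective (bimodule U s.obj)] (X : TriMat T U) :
    Projective ((restrictAlong (incl z hz)).obj ((representable _).obj (op X))) := by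
  obtain ⟨n, π, ι, hπι⟩ := hs X.t
  let F := (restrictAlong (incl (U := U) z hz)).obj ((representable _).obj (op X))
  let a : Fin n → (F ⟶ bimodule U s.obj) := fun k => ObjectProperty.homMk
    { app := fun Y => AddCommGrpCat.ofHom (AddMonoidHom.mk'
        (fun φ : X ⟶ (incl z hz).obj Y => (ι k).hom ≫ φ.h) fun φ ψ =>
          Preadditive.comp_add _ _ _ _ _ _)
      naturality := fun Y Y' g => by
        ext φ
        let φ' : X ⟶ (incl z hz).obj Y := φ
        let h' : X.t.obj ⟶ Y.obj := φ'.h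
        let f' : X.t ⟶ z := φ'.f
        have : (ι k).hom ≫ (f'.hom ≫ (0 : z.obj ⟶ Y'.obj) + h' ≫ g.hom) =
            ((ι k).hom ≫ h') ≫ g.hom := by simp
        exact this }
  let b : Fin n → (bimodule U s.obj ⟶ F) := fun k => ObjectProperty.homMk
    { app := fun Y => AddCommGrpCat.ofHom (AddMonoidHom.mk'
        (fun h : s.obj ⟶ Y.obj => mkHom (X := X) (Y := (incl z hz).obj Y) 0 ((π k).hom ≫ h) 0)
        fun φ ψ => TriMat.hom_ext (add_zero _).symm (Preadditive.comp_add _ _ _ _ _ _)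
          (add_zero _).symm)
      naturality := fun Y Y' g => by
        ext h
        let h' : s.obj ⟶ Y.obj := h
        refine TriMat.hom_ext (hz.eq_of_tgt _ _) ?_ ?_
        · have : (π k).hom ≫ h' ≫ g.hom = (0 : X.t ⟶ z).hom ≫ (0 : z.obj ⟶ Y'.obj) +
              ((π k).hom ≫ h') ≫ g.hom := by simp
          exact this
        · exact (zero_comp (f := g)).symm }
  let c : F ⟶ (representable _).obj (op X.u) := ObjectProperty.homMk
    { app := fun Y => AddCommGrpCat.ofHom (AddMonoidHom.mk'
        (fun φ : X ⟶ (incl z hz).obj Y => φ.g) fun φ ψ => rfl)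
      naturality := fun Y Y' g => rfl }
  let d : (representable _).obj (op X.u) ⟶ F :=
    ModCat.ofElement (mkHom (X := X) (Y := (incl z hz).obj X.u) 0 0 (𝟙 _))
  have hsum : ∑ k, a k ≫ b k + c ≫ d = 𝟙 F := by
    refine ModCat.hom_ext fun Y φ => ?_
    let φ' : X ⟶ (incl z hz).obj Y := φ
    let h' : X.t.obj ⟶ Y.obj := φ'.h
    let g' : X.u ⟶ Y := φ'.g
    have h₁ : (∑ k, a k ≫ b k + c ≫ d).hom.app Y φ =
        ∑ k, mkHom (X := X) (Y := (incl z hz).obj Y) 0 ((π k).hom ≫ (ι k).hom ≫ h') 0 +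
          (mkHom 0 0 (𝟙 _) : X ⟶ (incl z hz).obj X.u) ≫ (incl z hz).map g' := by
      exact congrArg (· + (c ≫ d).hom.app Y φ)
        (ModCat.sum_app_apply (F := F) (G := F) Finset.univ (fun k => a k ≫ b k) φ)
    refine h₁.trans (TriMat.hom_ext (hz.eq_of_tgt _ _) ?_ ?_)
    · rw [add_h, sum_h]
      have : ∑ k, (π k).hom ≫ (ι k).hom ≫ h' + ((0 : X.t ⟶ z).hom ≫ (0 : z.obj ⟶ Y.obj) +
          (0 : X.t.obj ⟶ X.u.obj) ≫ g'.hom) = h' := by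
        have := congrArg (fun f : X.t ⟶ X.t => f.hom ≫ h') hπι
        simp only [← Category.assoc, comp_zero, zero_comp, add_zero, ← Preadditive.sum_comp]
        refine Eq.trans ?_ (this.trans (Category.id_comp h'))
        congr 1
        exact (map_sum (AddMonoidHom.mk' (fun f : X.t ⟶ X.t => f.hom) fun _ _ => rfl) _ _).symm
      exact this
    · rw [add_g, sum_g]
      have : ∑ k : Fin n, (0 : X.u ⟶ Y) + 𝟙 X.u ≫ g' = g' := by simp
      exact this
  refine ⟨fun {E G} f e he => ⟨∑ k, a k ≫ Projective.factorThru (b k ≫ f) e +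
    c ≫ Projective.factorThru (d ≫ f) e, ?_⟩⟩
  rw [Preadditive.add_comp, Preadditive.sum_comp]
  simp only [Category.assoc, Projective.factorThru_comp]
  conv_rhs => rw [← Category.id_comp f, ← hsum, Preadditive.add_comp, Preadditive.sum_comp]
  simp only [Category.assoc]

end

/-- The module is the quotient of `Λ((t, 0),-)` by the morphisms with `f = 0`; these are given by
`h` alone, and `w` generates them. -/
theorem isFP_projT_representable (z' : U.FullSubcategory) (hz' : IsZero z')
    (hC : HasWeakFiniteCoproducts (TriMat T U)) {t : T.FullSubcategory} {Z : U.FullSubcategory}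
    (w : t.obj ⟶ Z.obj) (hw : IsWeakReflection w) (z : T.FullSubcategory) (hz : IsZero z) :
    IsFP ((restrictAlong (projT T U)).obj ((representable _).obj (op t))) := by
  let F := (restrictAlong (projT T U)).obj ((representable _).obj (op t))
  let X : TriMat T U := (inclT z' hz').obj t
  let q : (representable _).obj (op X) ⟶ F := ModCat.ofElement (𝟙 t : t ⟶ t)
  have hq : ∀ (Y : TriMat T U) (φ : X ⟶ Y), q.hom.app Y φ = φ.f := fun Y φ => Category.id_comp φ.f
  have : Epi q := (ModCat.epi_iff _).2 fun Y f => ⟨mkHom f 0 0, hq _ _⟩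
  refine (isFP_of_projective (isFG_representable X)).of_epi hC q
    (X := (incl z hz).obj Z) (mkHom 0 w 0 : X ⟶ (incl z hz).obj Z) (hq _ _) fun Y φ h => ?_
  let φ' : X ⟶ Y := φ
  obtain ⟨g, hg⟩ := hw Y.u φ'.h
  refine ⟨mkHom 0 0 g, TriMat.hom_ext ?_ ?_ (hz'.eq_of_src _ _)⟩
  · exact (comp_zero (f := (0 : t ⟶ z))).trans (h.symm.trans (hq Y φ))
  · have : (0 : t ⟶ z).hom ≫ (0 : z.obj ⟶ Y.u.obj) + w ≫ g.hom = w ≫ g.hom := by simp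
    exact this.trans hg

end TriMat

/-! ### Finite presentation of restricted and extended modules. -/

namespace TriMat

variable {K : Type u} [Field K] {C : Type u} [Category.{u} C] [Preadditive C] [Linear K C]
  {T U : ObjectProperty C}

/-- `(ℰ G)(s, 0)` is spanned by finitely many elements under the scalar endomorphisms of `s`,
if `G` is finitely generated. -/
theorem exists_span_extend (z : T.FullSubcategory) (hz : IsZero z) (z' : U.FullSubcategory)
    (hz' : IsZero z') {s : T.FullSubcategory}
    [Projective ((restrictAlong (incl (U := U) z hz)).obj
      ((representable _).obj (op ((inclT z' hz').obj s))))]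
    {Z : U.FullSubcategory} (w : s.obj ⟶ Z.obj) (hw : IsWeakReflection w)
    (hfin : ∀ Y Z : U.FullSubcategory, Module.Finite K (Y ⟶ Z)) {G : ModCat U.FullSubcategory}
    (hG : IsFG G) :
    ∃ (n : ℕ) (φ : Fin n → ((extendAlong (incl z hz)).obj G).obj.obj ((inclT z' hz').obj s)),
      ∀ ψ : ((extendAlong (incl z hz)).obj G).obj.obj ((inclT z' hz').obj s), ∃ c : Fin n → K,
        ∑ l, ((extendAlong (incl z hz)).obj G).obj.map ((inclT z' hz').map (c l • 𝟙 s)) (φ l) =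
          ψ := by
  obtain ⟨Z₀, g₀, hg₀⟩ := isFG_iff.1 hG
  let X₀ : TriMat T U := (inclT z' hz').obj s
  let M := (restrictAlong (incl (U := U) z hz)).obj ((representable _).obj (op X₀))
  let m : M.obj.obj Z := mkHom (X := X₀) (Y := (incl z hz).obj Z) 0 w 0
  let p : (representable _).obj (op Z) ⟶ M := ModCat.ofElement m
  have hp : Epi p := (ModCat.epi_iff _).2 fun Y φ => by
    let φ' : X₀ ⟶ (incl z hz).obj Y := φ
    let h' : s.obj ⟶ Y.obj := φ'.h
    obtain ⟨g, hg⟩ := hw Y h'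
    refine ⟨g, TriMat.hom_ext (hz.eq_of_tgt _ _) ?_ (hz'.eq_of_src _ _)⟩
    have : (0 : s ⟶ z).hom ≫ (0 : z.obj ⟶ Y.obj) + w ≫ g.hom = h' := by rw [hg]; simp
    exact this
  -- The module `M` is a summand of `𝒰(Z,-)`, so `Hom(M, G)` is the image of `G(Z)` under `θ`. In
  -- turn `G(Z)` is a quotient of the finite-dimensional space `𝒰(Z₀, Z)`.
  let σ : M ⟶ (representable _).obj (op Z) := Projective.factorThru (𝟙 M) p
  have hσ : σ ≫ p = 𝟙 M := Projective.factorThru_comp _ _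
  obtain ⟨n, b, hb⟩ := Module.Finite.exists_fin (R := K) (M := (Z₀ ⟶ Z))
  let θ : G.obj.obj Z → (M ⟶ G) := fun y => σ ≫ ModCat.ofElement y
  have hθ : ∀ y (Y : U.FullSubcategory) (x : M.obj.obj Y), (θ y).hom.app Y x =
      G.obj.map (show Z ⟶ Y from σ.hom.app Y x) y := fun y Y x => rfl
  -- Scalars on `s` act on `Hom(M, G)` as scalars on `Z` act on `G(Z)`, so linear combinations can
  -- be computed in `G(Z)`.
  have hscal : ∀ (k : K) (y : G.obj.obj Z),
      ((extendAlong (incl z hz)).obj G).obj.map ((inclT z' hz').map (k • 𝟙 s)) (θ y) =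
        θ (G.obj.map (k • 𝟙 Z) y) := by
    intro k y
    refine ModCat.hom_ext (C := U.FullSubcategory) fun Y x => ?_
    let x' : X₀ ⟶ (incl z hz).obj Y := x
    have h₁ : ((inclT z' hz').map (k • 𝟙 s) ≫ x' : X₀ ⟶ (incl z hz).obj Y) =
        M.obj.map (k • 𝟙 Y) x := by
      refine TriMat.hom_ext (hz.eq_of_tgt _ _) ?_ (hz'.eq_of_src _ _)
      let h' : s.obj ⟶ Y.obj := x'.h
      let g' : z' ⟶ Y := x'.g
      let f' : s ⟶ z := x'.f
      have : (k • 𝟙 s : s ⟶ s).hom ≫ h' + (0 : s.obj ⟶ z'.obj) ≫ g'.hom =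
          f'.hom ≫ (0 : z.obj ⟶ Y.obj) + h' ≫ (k • 𝟙 Y : Y ⟶ Y).hom := by
        change (k • 𝟙 s.obj) ≫ h' + _ = _ + h' ≫ (k • 𝟙 Y.obj)
        simp
      exact this
    refine Eq.trans (b := (θ y).hom.app Y (M.obj.map (k • 𝟙 Y) x)) ?_ ?_
    · exact congrArg ((θ y).hom.app Y) h₁
    · rw [ModCat.naturality_apply, hθ, hθ, ← G.map_comp_apply, ← G.map_comp_apply]
      let v : Z ⟶ Y := σ.hom.app Y x
      have hv : v ≫ (k • 𝟙 Y) = (k • 𝟙 Z) ≫ v := by simp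
      exact congrArg (fun f => G.obj.map f y) hv
  refine ⟨n, fun l => θ (G.obj.map (b l) g₀), fun ψ => ?_⟩
  let ψ' : M ⟶ G := ψ
  obtain ⟨f, hf⟩ := hg₀ Z (ψ'.hom.app Z m)
  have hfb : f ∈ Submodule.span K (Set.range b) := hb ▸ Submodule.mem_top
  obtain ⟨c, rfl⟩ := (Submodule.mem_span_range_iff_exists_fun K).1 hfb
  refine ⟨c, ?_⟩
  have hψ : ψ' = θ (ψ'.hom.app Z m) := by
    change ψ' = σ ≫ ModCat.ofElement (ψ'.hom.app Z m)
    rw [← ModCat.ofElement_comp m ψ', ← Category.assoc]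
    exact ((congrArg (· ≫ ψ') hσ).trans (Category.id_comp ψ')).symm
  refine Eq.trans ?_ hψ.symm
  refine (Finset.sum_congr rfl fun l _ => hscal (c l) _).trans ?_
  rw [← hf]
  refine ModCat.hom_ext (C := U.FullSubcategory) fun Y x => ?_
  refine (ModCat.sum_app_apply (F := M) (G := G) _ _ x).trans ?_
  simp only [hθ]
  rw [← map_sum, G.map_sum_apply]
  congr 1
  refine Finset.sum_congr rfl fun l _ => ?_
  rw [← G.map_comp_apply]
  congr 2
  simp

section

variable (z : T.FullSubcategory) (hz : IsZero z) (z' : U.FullSubcategory) (hz' : IsZero z')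
  (hU : HasWeakFiniteCoproducts U.FullSubcategory)
  (hΛ : HasWeakFiniteCoproducts (TriMat T U))
  {s : T.FullSubcategory} (hs : IsAdditiveGenerator s)

include hU in
theorem isFP_restrict
    (hw : ∀ t : T.FullSubcategory, ∃ (Z : U.FullSubcategory) (w : t.obj ⟶ Z.obj),
      IsWeakReflection w)
    (hE : (extendAlong (incl (U := U) z hz)).PreservesEpimorphisms)
    {F : ModCat (TriMat T U)} (hF : IsFP F) : IsFP ((restrictAlong (incl z hz)).obj F) := by
  refine hF.map (fun X => ?_) fun P => (restrictExtendAdjunction _).map_projective P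
  obtain ⟨Z, w, hw⟩ := hw X.t
  exact isFG_restrict_representable z hz hU X w hw

include z hz in
theorem isFP_extendByZero {G : ModCat U.FullSubcategory} (hG : IsFP G) :
    IsFP ((restrictAlong (projU T U)).obj G) :=
  hG.map (isFG_projU_representable z hz) fun P =>
    (restrictAlongAdjunction (inclAdjunction z hz)).map_projective P

include hU hΛ hs hz' in
-- In `0 → JℛℰG → ℰG → Q → 0` the first term is `J` of a copy of `G`. The quotient `Q` is inflated
-- from a finitely generated, hence projective, `𝒯`-module `W`, and inflations of representable
-- `𝒯`-modules are finitely presented.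
theorem isFP_extend [Projective (bimodule U s.obj)]
    (hT : HasWeakFiniteCoproducts T.FullSubcategory)
    (hs' : Function.Surjective (algebraMap K (End s)))
    (hw : ∀ t : T.FullSubcategory, ∃ (Z : U.FullSubcategory) (w : t.obj ⟶ Z.obj),
      IsWeakReflection w)
    (hfin : ∀ Y Z : U.FullSubcategory, Module.Finite K (Y ⟶ Z))
    {G : ModCat U.FullSubcategory} (hG : IsFP G) :
    IsFP ((extendAlong (incl z hz)).obj G) := by
  let adj₁ := restrictAlongAdjunction (inclAdjunction (U := U) z hz)
  let adj₂ := restrictExtendAdjunction (incl (U := U) z hz)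
  let adj' := restrictAlongAdjunction (projTAdjunction (T := T) z' hz')
  have : IsIso adj₁.unit := inferInstanceAs
    (IsIso (restrictAlongAdjunction (inclAdjunction (U := U) z hz)).unit)
  have := isIso_counit_of_isIso_unit adj₁ adj₂
  let E := (extendAlong (incl (U := U) z hz)).obj G
  let c : (restrictAlong (projU T U)).obj ((restrictAlong (incl z hz)).obj E) ⟶ E :=
    adj₁.counit.app E
  have hc : Mono c := mono_counit z hz E
  refine IsFP.of_shortExact hΛ (shortExact_cokernel c) ?_ ?_
  · have : IsFP ((restrictAlong (incl z hz)).obj E) :=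
      hG.of_retract hU (asIso (adj₂.counit.app G)).retract
    exact isFP_extendByZero z hz this
  · have hQ : IsZero ((restrictAlong (incl z hz)).obj (cokernel c)) := by
      have := isIso_map_counit adj₁ E
      exact isZero_map_cokernel _ (adj₁.counit.app E)
    have := isIso_unit_of_isZero z hz z' hz' _ hQ
    let W := (restrictAlong (inclT z' hz')).obj (cokernel c)
    have hW : IsFG W := by
      obtain ⟨Z, w, hw⟩ := hw s
      have := projective_restrict_representable z hz hs ((inclT z' hz').obj s)
      obtain ⟨n, φ, hφ⟩ := exists_span_extend z hz z' hz' w hw hfin hG.isFG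
      refine isFG_of_generator hs hT
        (fun l => (cokernel.π c).hom.app ((inclT z' hz').obj s) (φ l)) fun y => ?_
      obtain ⟨ψ, rfl⟩ := (ModCat.epi_iff (cokernel.π c)).1 inferInstance _ y
      obtain ⟨k, rfl⟩ := hφ ψ
      refine ⟨fun l => k l • 𝟙 s, ?_⟩
      rw [map_sum]
      exact Finset.sum_congr rfl fun l _ => (ModCat.naturality_apply (cokernel.π c)
        ((inclT z' hz').map (k l • 𝟙 s)) (φ l)).symm
    obtain ⟨t, e, he⟩ := hW
    obtain ⟨Z, w, hw⟩ := hw t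
    have hWp : Projective W := ModCat.projective_of_generator hs _ hs' W
    have hret : Retract W ((representable _).obj (op t)) :=
      { i := Projective.factorThru (𝟙 W) e, r := e, retract := Projective.factorThru_comp _ _ }
    have h₁ := isFP_projT_representable z' hz' hΛ w hw z hz
    exact (h₁.of_retract hΛ (hret.map (restrictAlong (projT T U)))).of_retract hΛ
      (asIso (adj'.unit.app (cokernel c))).retract

end

end TriMat

/-! ### The linear structure of the path category -/

section LinearMat

variable {K : Type*} [Semiring K] {D : Type*} [Category D] [Preadditive D] [Linear K D]

instance : Linear K (Mat_ D) where
  homModule M N := inferInstanceAs (Module K (∀ i j, M.X i ⟶ N.X j))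
  smul_comp M N L r f g := by
    ext i k
    change ∑ j, (r • f i j) ≫ g j k = r • ∑ j, f i j ≫ g j k
    simp [Finset.smul_sum]
  comp_smul M N L f r g := by
    ext i k
    change ∑ j, f i j ≫ (r • g j k) = r • ∑ j, f i j ≫ g j k
    simp [Finset.smul_sum]

end LinearMat

section Path

variable {K V : Type u} [Field K] [Quiver.{u} V] (I : PathIdeal K V)

instance : (Quotient.functor I.rel).Additive where
  map_add := rfl

noncomputable instance : Linear K (BoundCat I) :=
  Quotient.linear K I.rel fun a X Y f g h i j => by
    have := (I.component _ _).smul_mem a (h i j)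
    rwa [smul_sub] at this

namespace BoundCat

variable {I}

/-- The matrices of linear combinations of paths. -/
abbrev Entries (S T : VertexSum V) : Type u :=
  ∀ (i : Fin S.n) (j : Fin T.n),
    Free.of K (show Paths V from S.X i) ⟶ Free.of K (show Paths V from T.X j)

/-- The morphism of `BoundCat I` given by a matrix. -/
noncomputable def ofMatrix {S T : VertexSum V} (m : Entries (K := K) S T) :
    (⟨S⟩ : BoundCat I) ⟶ ⟨T⟩ :=
  (Quotient.functor I.rel).map (X := S) (Y := T) ⟨m⟩

/-- The identity matrix. -/
noncomputable def one (S : VertexSum V) : Entries (K := K) S S :=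
  (𝟙 (VertexSum.toMat K S) : Mat_.Hom _ _)

theorem one_self (S : VertexSum V) (i : Fin S.n) : one (K := K) S i i = 𝟙 _ :=
  Mat_.id_apply_self _ _

theorem one_of_ne (S : VertexSum V) {i j : Fin S.n} (h : i ≠ j) : one (K := K) S i j = 0 :=
  Mat_.id_apply_of_ne _ _ _ h

theorem sum_one_comp_one (S : VertexSum V) (i j : Fin S.n) :
    ∑ k, one (K := K) S i k ≫ one S k j = one S i j :=
  congrArg (fun f : Mat_.Hom _ _ => f i j) (Category.id_comp (𝟙 (VertexSum.toMat K S)))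

theorem ofMatrix_sum {S T : VertexSum V} {κ : Type} [Fintype κ] (m : κ → Entries (K := K) S T) :
    ∑ k, (ofMatrix (m k) : (⟨S⟩ : BoundCat I) ⟶ ⟨T⟩) = ofMatrix fun i j => ∑ k, m k i j := by
  let φ : Entries (K := K) S T →+ ((⟨S⟩ : BoundCat I) ⟶ ⟨T⟩) :=
    ⟨⟨ofMatrix, rfl⟩, fun _ _ => rfl⟩
  refine (map_sum φ m Finset.univ).symm.trans (congrArg φ ?_)
  ext i j : 2
  simp only [Finset.sum_apply]

/-- The inclusion of a summand. -/
noncomputable def ι (S : BoundCat I) (k : Fin S.as.n) : vertex I (S.as.X k) ⟶ S :=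
  ofMatrix (S := ⟨1, fun _ => S.as.X k⟩) fun _ j => one S.as k j

/-- The projection onto a summand. -/
noncomputable def π (S : BoundCat I) (k : Fin S.as.n) : S ⟶ vertex I (S.as.X k) :=
  ofMatrix (T := ⟨1, fun _ => S.as.X k⟩) fun i _ => one S.as i k

theorem sum_π_ι (S : BoundCat I) : ∑ k, π S k ≫ ι S k = 𝟙 S := by
  refine (ofMatrix_sum (S := S.as) (T := S.as) fun (k : Fin S.as.n) i j =>
    ∑ _ : Fin 1, one S.as i k ≫ one S.as k j).trans (congrArg ofMatrix ?_)
  ext i j : 2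
  exact (Finset.sum_congr rfl fun k _ => Fin.sum_univ_one _).trans (sum_one_comp_one S.as i j)

theorem ι_π_self (S : BoundCat I) (k : Fin S.as.n) : ι S k ≫ π S k = 𝟙 _ := by
  refine congrArg (ofMatrix (I := I) (S := ⟨1, fun _ => S.as.X k⟩) (T := ⟨1, fun _ => S.as.X k⟩)) ?_
  ext i j : 2
  obtain rfl : i = j := Subsingleton.elim (α := Fin 1) i j
  exact (sum_one_comp_one S.as k k).trans ((one_self _ _).trans
    (one_self ⟨1, fun _ => S.as.X k⟩ i).symm)

theorem ι_π_of_ne (S : BoundCat I) {k l : Fin S.as.n} (h : k ≠ l) : ι S k ≫ π S l = 0 := by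
  refine congrArg (ofMatrix (I := I) (S := ⟨1, fun _ => S.as.X k⟩) (T := ⟨1, fun _ => S.as.X l⟩)) ?_
  ext i j : 2
  exact (sum_one_comp_one S.as k l).trans (one_of_ne _ h)

variable (I) in
/-- A path as a morphism between vertices. -/
noncomputable def ofPath {x y : V} (p : Quiver.Path x y) : vertex I x ⟶ vertex I y :=
  ofMatrix (S := ⟨1, fun _ => x⟩) (T := ⟨1, fun _ => y⟩)
    fun _ _ => (Finsupp.single p 1 : Quiver.Path x y →₀ K)

theorem ofPath_nil (x : V) : ofPath I (Quiver.Path.nil : Quiver.Path x x) = 𝟙 _ := by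
  refine congrArg (ofMatrix (I := I) (S := ⟨1, fun _ => x⟩) (T := ⟨1, fun _ => x⟩)) ?_
  ext i j : 2
  obtain rfl : i = j := Subsingleton.elim (α := Fin 1) i j
  exact (one_self ⟨1, fun _ => x⟩ i).symm

theorem ofPath_comp {x y w : V} (p : Quiver.Path x y) (q : Quiver.Path y w) :
    ofPath I (p.comp q) = ofPath I p ≫ ofPath I q := by
  refine congrArg (ofMatrix (I := I) (S := ⟨1, fun _ => x⟩) (T := ⟨1, fun _ => w⟩)) ?_
  ext i j : 2
  refine Eq.trans ?_ (Fin.sum_univ_one _).symm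
  have := Free.single_comp_single K (Paths V) (X := (x : Paths V)) (Y := (y : Paths V))
    (Z := (w : Paths V)) p q 1 1
  rw [one_mul] at this
  exact this.symm

theorem span_ofPath (x y : V) :
    Submodule.span K (Set.range (ofPath I : Quiver.Path x y → _)) = ⊤ := by
  refine Submodule.eq_top_iff'.2 fun f => ?_
  let φ : (Quiver.Path x y →₀ K) →ₗ[K] (vertex I x ⟶ vertex I y) :=
    { toFun := fun c => ofMatrix (S := ⟨1, fun _ => x⟩) (T := ⟨1, fun _ => y⟩) fun _ _ => c
      map_add' := fun _ _ => rfl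
      map_smul' := fun _ _ => rfl }
  obtain ⟨c, rfl⟩ : ∃ c, φ c = f := by
    obtain ⟨g, rfl⟩ := (Quotient.functor I.rel).map_surjective f
    refine ⟨g.hom (0 : Fin 1) (0 : Fin 1),
      congrArg (ofMatrix (I := I) (S := ⟨1, fun _ => x⟩) (T := ⟨1, fun _ => y⟩)) ?_⟩
    ext i j : 2
    obtain rfl : i = 0 := Subsingleton.elim (α := Fin 1) i 0
    obtain rfl : j = 0 := Subsingleton.elim (α := Fin 1) j 0
    rfl
  induction c using Finsupp.induction_linear with
  | zero => rw [map_zero]; exact Submodule.zero_mem _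
  | add c c' h h' => rw [map_add]; exact Submodule.add_mem _ h h'
  | single p a =>
    have : φ (Finsupp.single p a) = a • ofPath I p := by
      change _ = a • φ (Finsupp.single p 1)
      rw [← map_smul, Finsupp.smul_single, smul_eq_mul, mul_one]
    rw [this]
    exact Submodule.smul_mem _ _ (Submodule.subset_span ⟨p, rfl⟩)

theorem hom_eq_sum {S T : BoundCat I} (f : S ⟶ T) :
    f = ∑ k, ∑ l, π S k ≫ (ι S k ≫ f ≫ π T l) ≫ ι T l := by
  conv_lhs => rw [← Category.id_comp f, ← Category.comp_id f, ← sum_π_ι S, ← sum_π_ι T]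
  simp only [Preadditive.sum_comp, Preadditive.comp_sum, Category.assoc]
  exact Finset.sum_comm

theorem finite_hom (hQ : StronglyLocallyFinite V) (S T : BoundCat I) :
    Module.Finite K (S ⟶ T) := by
  have := hQ.finite_paths
  let κ := Σ (k : Fin S.as.n) (l : Fin T.as.n), Quiver.Path (S.as.X k) (T.as.X l)
  let v : κ → (S ⟶ T) := fun a => π S a.1 ≫ ofPath I a.2.2 ≫ ι T a.2.1
  have hv : Submodule.span K (Set.range v) = ⊤ := by
    refine Submodule.eq_top_iff'.2 fun f => ?_
    rw [hom_eq_sum f]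
    refine Submodule.sum_mem _ fun k _ => Submodule.sum_mem _ fun l _ => ?_
    have h : ∀ g : vertex I (S.as.X k) ⟶ vertex I (T.as.X l),
        π S k ≫ g ≫ ι T l ∈ Submodule.span K (Set.range v) := by
      intro g
      have hg : g ∈ Submodule.span K (Set.range (ofPath I)) := by
        rw [span_ofPath]; exact Submodule.mem_top
      induction hg using Submodule.span_induction with
      | mem x hx =>
        obtain ⟨p, rfl⟩ := hx
        exact Submodule.subset_span ⟨⟨k, l, p⟩, rfl⟩
      | zero => simp
      | add x y _ _ hx hy =>
        rw [Preadditive.add_comp, Preadditive.comp_add]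
        exact Submodule.add_mem _ hx hy
      | smul a x _ hx =>
        rw [Linear.smul_comp, Linear.comp_smul]
        exact Submodule.smul_mem _ _ hx
    exact h _
  exact ⟨⟨(Set.finite_range v).toFinset, by simpa using hv⟩⟩

/-- Finite families of objects have weak coproducts, whose vertices occur among the given
objects. -/
theorem exists_weakCoproduct (s : Set V) {κ : Type} [Fintype κ]
    (X : κ → (addVertices I s).FullSubcategory) :
    ∃ (Z : (addVertices I s).FullSubcategory) (i : ∀ k, X k ⟶ Z),
      ∀ (Y : BoundCat I) (f : ∀ k, (X k).obj ⟶ Y),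
        ∃ g : Z.obj ⟶ Y, ∀ k, (i k).hom ≫ g = f k := by
  let A := Σ k, Fin (X k).obj.as.n
  let e : Fin (Fintype.card A) ≃ A := (Fintype.equivFin A).symm
  let v : A → V := fun a => (X a.1).obj.as.X a.2
  let Z : BoundCat I := ⟨(⟨Fintype.card A, v ∘ e⟩ : VertexSum V)⟩
  -- The inclusions are reindexed from `Fin` to the pairs in `A`, with the dependent types
  -- transported along `e`.
  let j : ∀ a, vertex I (v a) ⟶ Z := Equiv.piCongrLeft (fun a => vertex I (v a) ⟶ Z) e (ι Z)
  have hj : ∀ m, j (e m) = ι Z m := fun m => Equiv.piCongrLeft_apply_apply _ e _ m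
  refine ⟨⟨Z, fun m => (X (e m).1).property (e m).2⟩,
    fun k => ObjectProperty.homMk (∑ l, π (X k).obj l ≫ j ⟨k, l⟩), fun Y f => ?_⟩
  let f' : ∀ a, vertex I (v a) ⟶ Y := fun a => ι (X a.1).obj a.2 ≫ f a.1
  let g : Z ⟶ Y := ∑ m, π Z m ≫ f' (e m)
  have hg : ∀ a, j a ≫ g = f' a := by
    intro a
    obtain ⟨m, rfl⟩ := e.surjective a
    rw [hj, Preadditive.comp_sum, Finset.sum_eq_single m]
    · rw [← Category.assoc, ι_π_self]
      exact Category.id_comp _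
    · intro m' _ hm
      rw [← Category.assoc, ι_π_of_ne Z hm.symm, zero_comp]
    · simp
  refine ⟨g, fun k => ?_⟩
  change (∑ l, π (X k).obj l ≫ j ⟨k, l⟩) ≫ g = f k
  simp only [Preadditive.sum_comp, Category.assoc, hg, f']
  simp only [← Category.assoc, ← Preadditive.sum_comp, sum_π_ι, Category.id_comp]

theorem hasWeakFiniteCoproducts (s : Set V) :
    HasWeakFiniteCoproducts (addVertices I s).FullSubcategory := by
  intro κ _ X
  obtain ⟨Z, i, h⟩ := exists_weakCoproduct s X
  refine ⟨Z, i, fun Y f => ?_⟩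
  obtain ⟨g, hg⟩ := h Y.obj fun k => (f k).hom
  exact ⟨ObjectProperty.homMk g, fun k => ObjectProperty.hom_ext _ (hg k)⟩

variable (I) in
/-- The vertex `x` as an object of `add {x}`. -/
def vertexAdd (x : V) : (addVertices I {x}).FullSubcategory :=
  ⟨vertex I x, fun _ => rfl⟩

theorem isAdditiveGenerator_vertexAdd (x : V) : IsAdditiveGenerator (vertexAdd I x) := by
  intro S
  have h : ∀ k, vertex I (S.obj.as.X k) = vertex I x := fun k =>
    congrArg (vertex I) (S.property k)
  refine ⟨S.obj.as.n, fun k => ObjectProperty.homMk (π S.obj k ≫ eqToHom (h k)),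
    fun k => ObjectProperty.homMk (eqToHom (h k).symm ≫ ι S.obj k), ?_⟩
  apply ObjectProperty.hom_ext
  refine (map_sum (⟨⟨fun f => f.hom, rfl⟩, fun _ _ => rfl⟩ : (S ⟶ S) →+ (S.obj ⟶ S.obj))
    _ _).trans ?_
  refine Eq.trans (Finset.sum_congr rfl fun k _ => ?_) (sum_π_ι S.obj)
  change (π S.obj k ≫ eqToHom (h k)) ≫ eqToHom (h k).symm ≫ ι S.obj k = _
  simp

/-- The only path from a source to itself is trivial. -/
theorem algebraMap_surjective_of_isSource {x : V} (hx : IsSourceVertex x) :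
    Function.Surjective (algebraMap K (End (vertexAdd I x))) := by
  intro f
  have hp : ∀ p : Quiver.Path x x, p = Quiver.Path.nil := by
    intro p
    cases p with
    | nil => rfl
    | cons q e => exact ((hx _).false e).elim
  have hf : ∀ g : vertex I x ⟶ vertex I x, g ∈ Submodule.span K (Set.range (ofPath I)) := by
    intro g
    rw [span_ofPath]; exact Submodule.mem_top
  have : Set.range (ofPath I : Quiver.Path x x → _) = {𝟙 (vertex I x)} := by
    ext g
    constructor
    · rintro ⟨p, rfl⟩
      rw [hp p]
      exact ofPath_nil x
    · rintro rfl
      exact ⟨_, ofPath_nil x⟩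
  rw [this] at hf
  obtain ⟨k, hk⟩ := Submodule.mem_span_singleton.1 (hf f.hom)
  refine ⟨k, ?_⟩
  rw [Algebra.algebraMap_eq_smul_one]
  exact ObjectProperty.hom_ext _ hk

/-- The morphisms out of a source factor through the sum of the arrows that start there. -/
theorem exists_factor_of_isSource (hQ : StronglyLocallyFinite V) {star : V}
    (hstar : IsSourceVertex star) : ∃ (Z : UCat I star) (w : vertex I star ⟶ Z.obj),
      ∀ (Y : UCat I star) (h : vertex I star ⟶ Y.obj), ∃ g : Z.obj ⟶ Y.obj, w ≫ g = h := by
  have := hQ.finite_out star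
  obtain ⟨n, ⟨e⟩⟩ := Finite.exists_equiv_fin (Σ y : V, star ⟶ y)
  let Z : BoundCat I := ⟨(⟨n, fun m => (e.symm m).1⟩ : VertexSum V)⟩
  have hne : ∀ a : Σ y : V, star ⟶ y, a.1 ≠ star := by
    rintro ⟨y, a⟩ (rfl : y = _)
    exact (hstar _).false a
  have hZ : addVertices I {x | x ≠ star} Z := fun m => hne (e.symm m)
  let w : vertex I star ⟶ Z := ∑ m, ofPath I (e.symm m).2.toPath ≫ ι Z m
  have hw : ∀ m, w ≫ π Z m = ofPath I (e.symm m).2.toPath := by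
    intro m
    rw [Preadditive.sum_comp, Finset.sum_eq_single m]
    · rw [Category.assoc, ι_π_self]
      exact Category.comp_id _
    · intro m' _ hm
      rw [Category.assoc, ι_π_of_ne Z hm, comp_zero]
    · simp
  have harrow : ∀ {y : V} (a : star ⟶ y), ∃ g, w ≫ g = ofPath I a.toPath := by
    intro y a
    have : ∀ m b, e.symm m = b → ∃ g, w ≫ g = ofPath I b.2.toPath := by
      rintro m _ rfl
      exact ⟨π Z m, hw m⟩
    exact this (e ⟨y, a⟩) ⟨y, a⟩ (e.symm_apply_apply _)
  -- A path is extended at its end, so the induction bottoms out at its first arrow, which factors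
  -- through `w`; later arrows are composed onto the factorization.
  have hpath : ∀ {b y : V} (q : Quiver.Path star b) (a : b ⟶ y),
      ∃ g, w ≫ g = ofPath I (q.cons a) := by
    intro b y q a
    induction q generalizing y with
    | nil => exact harrow a
    | cons q' a' ih =>
      obtain ⟨g, hg⟩ := ih a'
      exact ⟨g ≫ ofPath I a.toPath, by
        rw [← Category.assoc, hg, ← ofPath_comp]
        rfl⟩
  have hvertex : ∀ {y : V} (_ : y ≠ star) (f : vertex I star ⟶ vertex I y), ∃ g, w ≫ g = f := by
    intro y hy f
    have hf : f ∈ Submodule.span K (Set.range (ofPath I)) := by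
      rw [span_ofPath]; exact Submodule.mem_top
    induction hf using Submodule.span_induction with
    | mem x hx =>
      obtain ⟨p, rfl⟩ := hx
      cases p with
      -- The trivial path at `star` does not factor through `w` in general; `y ≠ star` excludes it.
      | nil => exact (hy rfl).elim
      | cons q a => exact hpath q a
    | zero => exact ⟨0, comp_zero⟩
    | add x y _ _ hx hy =>
      obtain ⟨g, rfl⟩ := hx
      obtain ⟨g', rfl⟩ := hy
      exact ⟨g + g', Preadditive.comp_add _ _ _ _ _ _⟩
    | smul a x _ hx =>
      obtain ⟨g, rfl⟩ := hx
      exact ⟨a • g, Linear.comp_smul _ _ _ _ _ _⟩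
  refine ⟨⟨Z, hZ⟩, w, fun Y h => ?_⟩
  choose g hg using fun l => hvertex (Y.property l) (h ≫ π Y.obj l)
  refine ⟨∑ l, g l ≫ ι Y.obj l, ?_⟩
  simp only [Preadditive.comp_sum, ← Category.assoc]
  simp only [hg]
  simp only [Category.assoc, ← Preadditive.comp_sum, sum_π_ι, Category.comp_id]

/-- Since `t` is a summand of finitely many copies of `*`, the weak coproduct of as many copies of
the target for `*` works. -/
theorem exists_weakReflection (hQ : StronglyLocallyFinite V) {star : V}
    (hstar : IsSourceVertex star) (t : (addVertices I {star}).FullSubcategory) :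
    ∃ (Z : UCat I star) (w : t.obj ⟶ Z.obj), TriMat.IsWeakReflection w := by
  obtain ⟨Z₀, w₀, h₀⟩ := exists_factor_of_isSource (I := I) hQ hstar
  obtain ⟨n, π, ι, hπι⟩ := isAdditiveGenerator_vertexAdd star t
  obtain ⟨Z, i, hZ⟩ := exists_weakCoproduct (I := I) {x | x ≠ star} fun _ : Fin n => Z₀
  refine ⟨Z, ∑ k, (π k).hom ≫ w₀ ≫ (i k).hom, fun Y h => ?_⟩
  choose g hg using fun k => h₀ Y ((ι k).hom ≫ h)
  obtain ⟨g', hg'⟩ := hZ Y.obj g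
  refine ⟨ObjectProperty.homMk g', ?_⟩
  have hk : ∀ k, ((π k).hom ≫ w₀ ≫ (i k).hom) ≫ g' = ((π k).hom ≫ (ι k).hom) ≫ h := by
    intro k
    refine (Category.assoc _ _ _).trans (Eq.trans ?_ (Category.assoc _ _ _).symm)
    exact congrArg ((π k).hom ≫ ·) ((Category.assoc _ _ _).trans
      ((congrArg (w₀ ≫ ·) (hg' k)).trans (hg k)))
  change (∑ k, (π k).hom ≫ w₀ ≫ (i k).hom) ≫ g' = h
  rw [Preadditive.sum_comp]
  simp only [hk]
  rw [← Preadditive.sum_comp]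
  have h₂ : ∑ k, (π k).hom ≫ (ι k).hom = 𝟙 t.obj :=
    (map_sum (⟨⟨fun f => f.hom, rfl⟩, fun _ _ => rfl⟩ : (t ⟶ t) →+ (t.obj ⟶ t.obj)) _ _).symm.trans
      (congrArg (fun f : t ⟶ t => f.hom) hπι)
  rw [h₂, Category.id_comp]

theorem finite_hom_fullSubcategory (hQ : StronglyLocallyFinite V)
    {P : ObjectProperty (BoundCat I)} (Y Z : P.FullSubcategory) : Module.Finite K (Y ⟶ Z) := by
  have := finite_hom hQ Y.obj Z.obj
  exact Module.Finite.of_injective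
    (⟨⟨fun f => f.hom, fun _ _ => rfl⟩, fun _ _ => rfl⟩ : (Y ⟶ Z) →ₗ[K] (Y.obj ⟶ Z.obj))
    fun _ _ h => ObjectProperty.hom_ext _ h

end BoundCat

end Path

/-! ### Orthogonal and exceptional pairs -/

section Pairs

variable {A B : Type u} [Category.{u} A] [Preadditive A] [Category.{u} B] [Preadditive B]

theorem IsOrthogonalPair.map {X Y : ModCat A} {M N : ModCat B}
    (h : letI := HasExt.standard (ModCat A); letI := HasExt.standard (ModCat B)
      ∀ n, (Subsingleton (Abelian.Ext.{u + 1} X Y (n + 1)) →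
        Subsingleton (Abelian.Ext.{u + 1} M N (n + 1))) ∧
      (Subsingleton (Abelian.Ext.{u + 1} Y X (n + 1)) →
        Subsingleton (Abelian.Ext.{u + 1} N M (n + 1))))
    (hXY : IsOrthogonalPair X Y) : IsOrthogonalPair M N := by
  intro j hj
  obtain ⟨n, rfl⟩ : ∃ n, j = n + 1 := ⟨j - 1, by omega⟩
  exact ⟨(h n).1 (hXY _ hj).1, (h n).2 (hXY _ hj).2⟩

variable {J : ModCat B ⥤ ModCat A} {R : ModCat A ⥤ ModCat B} {E : ModCat B ⥤ ModCat A}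
  [R.Additive] [PreservesFiniteLimits R] [PreservesFiniteColimits R]

theorem HasFinitePD.map_leftAdjoint (adj₂ : R ⊣ E) [E.PreservesEpimorphisms] {X : ModCat A}
    (h : HasFinitePD X) : HasFinitePD (R.obj X) := by
  obtain ⟨n, hn⟩ := h
  have : HasProjectiveDimensionLT X (n + 1) := hn
  exact ⟨n, hasProjectiveDimensionLT_leftAdjoint adj₂ n X⟩

theorem HasFinitePD.of_map (adj₁ : J ⊣ R) [IsIso adj₁.unit] [J.Additive] [PreservesFiniteLimits J]
    (hpd : ∀ Q, IsZero (R.obj Q) → HasProjectiveDimensionLT Q 2)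
    (hmono : ∀ X, Mono (adj₁.counit.app X)) {X : ModCat A} (h : HasFinitePD (R.obj X)) :
    HasFinitePD X := by
  obtain ⟨n, hn⟩ := h
  have : HasProjectiveDimensionLT (R.obj X) (n + 1) := hn
  exact ⟨n + 1, exists_hasProjectiveDimensionLE adj₁ hpd hmono X n⟩

theorem HasFinitePD.of_iso {X Y : ModCat A} (e : X ≅ Y) (h : HasFinitePD X) : HasFinitePD Y := by
  obtain ⟨n, hn⟩ := h
  have : HasProjectiveDimensionLT X (n + 1) := hn
  exact ⟨n, hasProjectiveDimensionLT_of_iso e (n + 1)⟩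

end Pairs

/-! ### The one-point extension by a projective. -/

theorem mainTheorem5 (K V : Type u) [Field K] [Quiver.{u} V]
    (hQ : StronglyLocallyFinite V) (star : V) (hstar : IsSourceVertex star)
    (I : PathIdeal K V) (hproj : Projective (extensionModule I star)) :
    ∃ (hR : ∀ F, IsFP F → IsFP ((restriction I star).obj F))
      (hE : ∀ G, IsFP G → IsFP ((extension I star).obj G)),
      (restrictionFP I star hR).Additive ∧
      (extensionFP I star hE).Additive ∧
      Nonempty (restrictionFP I star hR ⊣ extensionFP I star hE) ∧
      -- both functors preserve orthogonal pairs
      (∀ X Y : FPModCat (LambdaCat I star), IsOrthogonalPair X.obj Y.obj →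
        IsOrthogonalPair ((restrictionFP I star hR).obj X).obj
          ((restrictionFP I star hR).obj Y).obj) ∧
      (∀ M N : FPModCat (UCat I star), IsOrthogonalPair M.obj N.obj →
        IsOrthogonalPair ((extensionFP I star hE).obj M).obj
          ((extensionFP I star hE).obj N).obj) ∧
      -- both functors preserve exceptional pairs
      (∀ X Y : FPModCat (LambdaCat I star), IsExceptionalPair X.obj Y.obj →
        IsExceptionalPair ((restrictionFP I star hR).obj X).obj
          ((restrictionFP I star hR).obj Y).obj) ∧
      (∀ M N : FPModCat (UCat I star), IsExceptionalPair M.obj N.obj →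
        IsExceptionalPair ((extensionFP I star hE).obj M).obj
          ((extensionFP I star hE).obj N).obj) ∧
      -- finiteness of all projective dimensions passes from either module category to the other
      ((∀ X : FPModCat (LambdaCat I star), HasFinitePD X.obj) ↔
        ∀ M : FPModCat (UCat I star), HasFinitePD M.obj) := by
  let z := addVertices.zero I {star}
  have hz : IsZero z := addVertices.isZero_zero I {star}
  let z' : UCat I star := addVertices.zero I {x | x ≠ star}
  have hz' : IsZero z' := addVertices.isZero_zero I {x | x ≠ star}
  let s := BoundCat.vertexAdd I star
  have hs : IsAdditiveGenerator s := BoundCat.isAdditiveGenerator_vertexAdd star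
  have hs' : Function.Surjective (algebraMap K (End s)) :=
    BoundCat.algebraMap_surjective_of_isSource hstar
  have hw := BoundCat.exists_weakReflection (I := I) hQ hstar
  have hU : HasWeakFiniteCoproducts (UCat I star) := BoundCat.hasWeakFiniteCoproducts _
  have hT : HasWeakFiniteCoproducts (addVertices I {star}).FullSubcategory :=
    BoundCat.hasWeakFiniteCoproducts _
  have hΛ : HasWeakFiniteCoproducts (LambdaCat I star) :=
    TriMat.hasWeakFiniteCoproducts hU fun _ _ X => BoundCat.exists_weakCoproduct _ X
  have hfin : ∀ Y Z : UCat I star, Module.Finite K (Y ⟶ Z) :=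
    BoundCat.finite_hom_fullSubcategory hQ
  have : Projective (TriMat.bimodule (addVertices I {x | x ≠ star}) s.obj) := hproj
  let R : ModCat (LambdaCat I star) ⥤ ModCat (UCat I star) := restrictAlong (TriMat.incl z hz)
  let E : ModCat (UCat I star) ⥤ ModCat (LambdaCat I star) := extendAlong (TriMat.incl z hz)
  let J : ModCat (UCat I star) ⥤ ModCat (LambdaCat I star) := restrictAlong (TriMat.projU _ _)
  have hepi : E.PreservesEpimorphisms := extendAlong_preservesEpimorphisms _ fun X =>
    TriMat.projective_restrict_representable z hz hs X
  let adj₁ : J ⊣ R := restrictAlongAdjunction (TriMat.inclAdjunction z hz)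
  let adj₂ : R ⊣ E := restrictExtendAdjunction (TriMat.incl z hz)
  have hunit : IsIso adj₁.unit := inferInstanceAs
    (IsIso (restrictAlongAdjunction (TriMat.inclAdjunction z hz)).unit)
  have hRadd : R.Additive := inferInstanceAs (restrictAlong (TriMat.incl z hz)).Additive
  have hEadd : E.Additive := inferInstanceAs (extendAlong (TriMat.incl z hz)).Additive
  have hJadd : J.Additive := inferInstanceAs (restrictAlong (TriMat.projU _ _)).Additive
  have hRlim : PreservesFiniteLimits R :=
    inferInstanceAs (PreservesFiniteLimits (restrictAlong (TriMat.incl z hz)))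
  have hRcolim : PreservesFiniteColimits R :=
    inferInstanceAs (PreservesFiniteColimits (restrictAlong (TriMat.incl z hz)))
  have hJlim : PreservesFiniteLimits J :=
    inferInstanceAs (PreservesFiniteLimits (restrictAlong (TriMat.projU _ _)))
  let adj' := restrictAlongAdjunction
    (TriMat.projTAdjunction (T := addVertices I {star}) z' hz')
  have hunit' : ∀ Q, IsZero (R.obj Q) → IsIso (adj'.unit.app Q) :=
    TriMat.isIso_unit_of_isZero z hz z' hz'
  have hmono : ∀ X, Mono (adj₁.counit.app X) := TriMat.mono_counit z hz
  have hinj : ∀ Q, IsZero (R.obj Q) → Injective Q :=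
    injective_of_isZero_obj adj' hunit' (ModCat.injective_of_generator hs _ hs')
  have hpd : ∀ Q, IsZero (R.obj Q) → HasProjectiveDimensionLT Q 2 :=
    hasProjectiveDimensionLT_two_of_isZero_obj adj₁ adj' hunit'
      (fun P hP => adj₂.map_projective P hP) hmono (ModCat.projective_of_generator hs _ hs')
  have hR : ∀ F, IsFP F → IsFP (R.obj F) := fun F hF => TriMat.isFP_restrict z hz hU hw hepi hF
  have hE : ∀ G, IsFP G → IsFP (E.obj G) := fun G hG =>
    TriMat.isFP_extend z hz z' hz' hU hΛ hs hT hs' hw hfin hG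
  have hcounit := isIso_counit_of_isIso_unit adj₁ adj₂
  have hRE : ∀ M, R.obj (E.obj M) ≅ M := fun M => asIso (adj₂.counit.app M)
  have hRorth : ∀ X Y, IsOrthogonalPair X Y → IsOrthogonalPair (R.obj X) (R.obj Y) := by
    intro X Y
    let := HasExt.standard (ModCat (LambdaCat I star))
    let := HasExt.standard (ModCat (UCat I star))
    exact IsOrthogonalPair.map fun n => ⟨subsingleton_ext_map_of_injective adj₁ adj₂ hinj,
      subsingleton_ext_map_of_injective adj₁ adj₂ hinj⟩
  have hEorth : ∀ M N, IsOrthogonalPair M N → IsOrthogonalPair (E.obj M) (E.obj N) := by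
    intro M N
    let := HasExt.standard (ModCat (LambdaCat I star))
    let := HasExt.standard (ModCat (UCat I star))
    exact IsOrthogonalPair.map fun n => ⟨subsingleton_ext_map_rightAdjoint adj₁ adj₂,
      subsingleton_ext_map_rightAdjoint adj₁ adj₂⟩
  have hRpd : ∀ X, HasFinitePD X → HasFinitePD (R.obj X) := fun X =>
    HasFinitePD.map_leftAdjoint adj₂
  have hpdR : ∀ X, HasFinitePD (R.obj X) → HasFinitePD X := fun X =>
    HasFinitePD.of_map adj₁ hpd hmono
  have hEpd : ∀ M, HasFinitePD M → HasFinitePD (E.obj M) := fun M h =>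
    hpdR _ (h.of_iso (hRE M).symm)
  refine ⟨hR, hE, ⟨fun {X Y f g} => ObjectProperty.hom_ext _ (R.map_add (f := f.hom) (g := g.hom))⟩,
    ⟨fun {X Y f g} => ObjectProperty.hom_ext _ (E.map_add (f := f.hom) (g := g.hom))⟩,
    ⟨adj₂.restrictFullyFaithful (ObjectProperty.fullyFaithfulι _)
      (ObjectProperty.fullyFaithfulι _) (Iso.refl _) (Iso.refl _)⟩,
    fun X Y => hRorth X.obj Y.obj, fun M N => hEorth M.obj N.obj,
    fun X Y h => ⟨hRorth _ _ h.1, hRpd _ h.2.1, hRpd _ h.2.2⟩,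
    fun M N h => ⟨hEorth _ _ h.1, hEpd _ h.2.1, hEpd _ h.2.2⟩, fun h M => ?_, fun h X => ?_⟩
  -- Every `M` is, up to isomorphism, the restriction of the finitely presented module `E M`.
  · exact (hRpd _ (h ⟨E.obj M.obj, hE _ M.property⟩)).of_iso (hRE M.obj)
  · exact hpdR _ (h ⟨R.obj X.obj, hR _ X.property⟩)
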